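/- **Setting.** Let $d\ge 1$, let $\|\cdot\|$ be the maximum norm on $\mathbb R^d$, and write $\le$ for the coordinatewise order. Let $Y=(Y_n)_{n\ge0}$ be independent $[0,\infty)^d$-valued random vectors such that $Y_n$, $n\ge1$, are identically distributed and the support of the law of $Y_1$ is unbounded. For random matrices $A_n\in[0,\infty)^{d\times d}$, $n\ge1$, define the autoregressive process $X$ and the max-autoregressive process $M$ by $X_0=M_0=Y_0$ and, for $n\ge1$, $$X_n=A_nX_{n-1}+Y_n,\qquad M_n=\max\{A_nM_{n-1},Y_n\}\quad\text{(coordinatewise maximum)}.$$ An environment assigns to each $n\ge1$ measurable functions $\Psi_n^j:[0,1]\to\mathbb N_0^d$, $j=1,\dots,d$ (possibly random). Let $(U^j_{m,n,k})_{0\le m<n,\;k\ge1,\;1\le j\le d}$ be i.i.d. uniform on $[0,1]$ and independent of $(\Psi,Y)$. Put $\xi^{i,j}_{m,n,k}=[\Psi_n^j(U^j_{m,n,k})]_i$, $B_{m,m}=\lfloor Y_m\rfloor$ (coordinatewise), and $$[B_{m,n}]_i=\sum_{j=1}^d\sum_{k=1}^{[B_{m,n-1}]_j}\xi^{i,j}_{m,n,k}\quad(n>m).$$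 The branching process with immigration is $Z_n=\sum_{m=0}^nB_{m,n}$, $n\ge0$. Whenever $Z$ is considered, $[A_n]_{i,j}$ is the conditional expectation of $\xi^{i,j}_{0,n,1}$ given the environment. Let $V$ be one of $X,M,Z$, and let $V^0$ be the Markov chain with the same transition kernel started at $0$ (that is, driven by the same data but with $Y_0$ replaced by $0$). The process $V$ is *recurrent* if it is irreducible, i.e. for every $x\in[0,\infty)^d$ there is $n\ge0$ with $P[V^0_n\ge x]>0$, and there is $b\in(0,\infty)$ with $\sum_{n\ge0}P[\|V^0_n\|\le b]=\infty$. **Theorem 3.1 (Subcritical case, constant environment).** Assume that there is a primitive matrix $A\in[0,\infty)^{d\times d}$ (that is, $A^K\in(0,\infty)^{d\times d}$ for some integer $K\ge1$) with spectral radius $\varrho<1$ such that a.s. $A_n=A$ for all $n\ge1$. Let $y\in(0,\infty)$ satisfy $P[\|Y_1\|\le y]>0$. Then the following are equivalent: * (XR) $X$ is recurrent. * (MR) $M$ is recurrent. * (RC) $\displaystyle\sum_{n\ge0}\prod_{m=0}^nP\big[\|Y_1\|\le y\varrho^{-m}\big]=\infty$. If in addition the environment is constant, i.e. there are deterministic measurable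 functions $\psi^j:[0,1]\to\mathbb N_0^d$ with a.s. $\Psi_n=(\psi^j)_{j=1,\dots,d}$ for all $n\ge1$, and $E[\xi^{i,j}_{0,1,1}\ln\xi^{i,j}_{0,1,1}]<\infty$ for all $i,j\in\{1,\dots,d\}$ (with $0\ln0=0$), then (XR), (MR) and (RC) are also equivalent to: * (ZR) $Z$ is recurrent. -/

import Mathlib

open MeasureTheory ProbabilityTheory
open scoped ENNReal Matrix

noncomputable section

namespace ARBranching

/-- The autoregressive process driven by the coefficient matrices `A 1, A 2, …` and the
innovations `Y`: `X 0 = Y 0` and `X n = A n * X (n - 1) + Y n` for `n ≥ 1`. -/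
def arProcess {Ω : Type*} {d : ℕ} (A : ℕ → Ω → Matrix (Fin d) (Fin d) ℝ)
    (Y : ℕ → Ω → Fin d → ℝ) : ℕ → Ω → Fin d → ℝ
  | 0 => Y 0
  | n + 1 => fun ω => A (n + 1) ω *ᵥ arProcess A Y n ω + Y (n + 1) ω

/-- The max-autoregressive process: `M 0 = Y 0` and `M n = max (A n * M (n - 1)) (Y n)` for
`n ≥ 1`, the maximum being taken coordinatewise. -/
def maxArProcess {Ω : Type*} {d : ℕ} (A : ℕ → Ω → Matrix (Fin d) (Fin d) ℝ)
    (Y : ℕ → Ω → Fin d → ℝ) : ℕ → Ω → Fin d → ℝ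
  | 0 => Y 0
  | n + 1 => fun ω => (A (n + 1) ω *ᵥ maxArProcess A Y n ω) ⊔ Y (n + 1) ω

/-- A reproduction law for `d` types, realised on the unit interval: if `U` is uniform on `[0,1]`
then `ψ j U i` is the number of children of type `i` of an individual of type `j`. -/
abbrev Reproduction (d : ℕ) : Type := Fin d → unitInterval → Fin d → ℕ

/-- The matrix of expected offspring numbers: position `(i, j)` holds the expected number of
children of type `i` of an individual of type `j`. -/
def meanMatrix {d : ℕ} (ψ : Reproduction d) : Matrix (Fin d) (Fin d) ℝ :=
  fun i j => ∫ u : unitInterval, (ψ j u i : ℝ)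

/-- `offspring Ψ U m l k i j` is the number of children of type `i`, born in generation
`m + l + 1`, of the `k`-th individual of type `j` in generation `m + l` whose ancestors immigrated
at time `m`. Here `k` counts from `0`, and the family `U m l k j` (`m, l, k ≥ 0`) of uniform
variables is indexed by the immigration time `m` and by the age `l` of the parent's generation,
so that the pairs `(m, m + l + 1)` are exactly the pairs `(m, n)` with `0 ≤ m < n`. -/
def offspring {Ω : Type*} {d : ℕ} (Ψ : ℕ → Ω → Reproduction d)
    (U : ℕ → ℕ → ℕ → Fin d → Ω → unitInterval) (m l k : ℕ) (i j : Fin d) (ω : Ω) : ℕ :=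
  Ψ (m + l + 1) ω j (U m l k j ω) i

/-- `descendants Ψ U Y m l` is the vector of the numbers of individuals of each type alive in
generation `m + l` that descend from the immigrants `⌊Y m⌋` of time `m`. -/
def descendants {Ω : Type*} {d : ℕ} (Ψ : ℕ → Ω → Reproduction d)
    (U : ℕ → ℕ → ℕ → Fin d → Ω → unitInterval) (Y : ℕ → Ω → Fin d → ℝ) (m : ℕ) :
    ℕ → Ω → Fin d → ℕ
  | 0 => fun ω i => ⌊Y m ω i⌋₊
  | l + 1 => fun ω i =>
      ∑ j, ∑ k ∈ Finset.range (descendants Ψ U Y m l ω j), offspring Ψ U m l k i j ω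

/-- The multitype branching process with immigration `⌊Y⌋` in the environment `Ψ`, as a process
of vectors with nonnegative (integer) real coordinates. -/
def branchingProcess {Ω : Type*} {d : ℕ} (Ψ : ℕ → Ω → Reproduction d)
    (U : ℕ → ℕ → ℕ → Fin d → Ω → unitInterval) (Y : ℕ → Ω → Fin d → ℝ) (n : ℕ) (ω : Ω) :
    Fin d → ℝ :=
  fun i => ((∑ m ∈ Finset.range (n + 1), descendants Ψ U Y m (n - m) ω i : ℕ) : ℝ)

/-- The same driving sequence with initial value `0`. Each of the three processes above, driven by
`fromZero Y`, is a Markov chain that starts at `0` and has the same transition kernel as the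
process driven by `Y`. -/
def fromZero {Ω : Type*} {d : ℕ} (Y : ℕ → Ω → Fin d → ℝ) : ℕ → Ω → Fin d → ℝ :=
  Function.update Y 0 0

/-- Irreducibility, for the state space `[0,∞)^d`, of the transition kernel of an order-preserving
Markov chain, expressed through the chain `V` with this kernel that starts at `0`. -/
def IrreducibleFromZero {Ω : Type*} [MeasurableSpace Ω] {d : ℕ} (P : Measure Ω)
    (V : ℕ → Ω → Fin d → ℝ) : Prop :=
  ∀ x : Fin d → ℝ, 0 ≤ x → ∃ n, 0 < P {ω | x ≤ V n ω}

/-- Recurrence of the transition kernel of an order-preserving Markov chain, expressed through the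
chain `V` with this kernel that starts at `0`: the kernel is irreducible and, for some finite
`b > 0`, the sum of the probabilities of `‖V n‖ ≤ b` diverges. The norm is the maximum norm. -/
def RecurrentFromZero {Ω : Type*} [MeasurableSpace Ω] {d : ℕ} (P : Measure Ω)
    (V : ℕ → Ω → Fin d → ℝ) : Prop :=
  IrreducibleFromZero P V ∧ ∃ b : ℝ, 0 < b ∧ ∑' n, P {ω | ‖V n ω‖ ≤ b} = ∞

/-- The autoregressive process `X` is recurrent. -/
def ARRecurrent {Ω : Type*} [MeasurableSpace Ω] {d : ℕ} (P : Measure Ω)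
    (A : ℕ → Ω → Matrix (Fin d) (Fin d) ℝ) (Y : ℕ → Ω → Fin d → ℝ) : Prop :=
  RecurrentFromZero P (arProcess A (fromZero Y))

/-- The max-autoregressive process `M` is recurrent. -/
def MaxARRecurrent {Ω : Type*} [MeasurableSpace Ω] {d : ℕ} (P : Measure Ω)
    (A : ℕ → Ω → Matrix (Fin d) (Fin d) ℝ) (Y : ℕ → Ω → Fin d → ℝ) : Prop :=
  RecurrentFromZero P (maxArProcess A (fromZero Y))

/-- The branching process with immigration `Z` is recurrent. -/
def BranchingRecurrent {Ω : Type*} [MeasurableSpace Ω] {d : ℕ} (P : Measure Ω)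
    (Ψ : ℕ → Ω → Reproduction d) (U : ℕ → ℕ → ℕ → Fin d → Ω → unitInterval)
    (Y : ℕ → Ω → Fin d → ℝ) : Prop :=
  RecurrentFromZero P (branchingProcess Ψ U (fromZero Y))

/-- The spectral radius of a real square matrix: the largest modulus of its complex eigenvalues. -/
def specRadius {d : ℕ} (A : Matrix (Fin d) (Fin d) ℝ) : ℝ :=
  (spectralRadius ℂ (A.map (algebraMap ℝ ℂ))).toReal

/-- Divergence of `∑ n, ∏ m ≤ n, P[‖Y 1‖ ≤ y * ρ ^ (-m)]`. -/
def CriterionDiverges {Ω : Type*} [MeasurableSpace Ω] {d : ℕ} (P : Measure Ω)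
    (Y : ℕ → Ω → Fin d → ℝ) (y ρ : ℝ) : Prop :=
  ∑' n : ℕ, ∏ m ∈ Finset.range (n + 1), P {ω | ‖Y 1 ω‖ ≤ y * (ρ ^ m)⁻¹} = ∞

end ARBranching

end

/-! Started from 0, the autoregressive process is $X_n=\sum_{m<n}A^mY_{n-m}$, and Perron–Frobenius
bounds give $A^m\asymp\varrho^m$ entrywise once $m$ is large (`exists_pow_bounds`). Hence $\|X_n\|$
and $\|M_n\|$ are governed by the independent numbers $\varrho^m\|Y_{n-m}\|$. The product in (RC) is
the probability that none of these exceeds $y$, and it has to be compared with the probability that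
the processes stay bounded.

Two estimates make the comparison, both resting on the fact that every factor is at least
$p=P[\|Y_1\|\le y]>0$. Given that all contributions are at most $y$, their sum has bounded mean,
because at a fixed innovation size the contributions below $y$ form a geometric progression.
Markov's inequality then shows that $X_n$ is bounded with conditional probability at least one half
(`exists_half_prod_le_measure_sum_le`). Conversely, replacing the indicator of $\varrho^mr\le y$ by
any function that is at most 1 and is $O((\varrho^mr)^{-1})$ above $y$ changes the product by at
most a constant factor, because the excess expectations are summable (`exists_prod_lintegral_le`).
In particular the level $y$ is immaterial. With $M\le X$ this closes the cycle (XR), (MR), (RC).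

For $Z$ let $\Phi$ be the log-Laplace transform of the reproduction law. Given the immigration,
$E\,e^{-w\cdot Z_n}=\exp(-\sum_m\Phi^m(w)\cdot\lfloor Y_{n-m}\rfloor)$
(`lintegral_exp_neg_sum_progeny`). Jensen's inequality yields $\Phi^m(w)\le wA^m$, so $Z_n$ is tight
on the event that $X_n$ is bounded, and (XR) implies (ZR). For small $w$ the $\xi\ln\xi$ condition
yields $\Phi^m(w)\ge\frac12wA^m$ (`exists_half_vecMul_le_iterate_logLaplace`). The probability that
$Z_n$ is bounded is then at most a constant times a product of the kind treated by the second
estimate, so (ZR) implies (RC). -/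

namespace ARBranching

/-! ### Geometric sums -/

/-- Each summand is dominated by an increment of the telescoping sequence
$\min(\rho^ms,y)/(1-\rho)$. -/
lemma sum_geometric_below_le {ρ s y : ℝ} (h0 : 0 < ρ) (h1 : ρ < 1) (hs : 0 ≤ s) (hy : 0 ≤ y)
    (n : ℕ) :
    ∑ m ∈ Finset.range n, (if ρ ^ m * s ≤ y then ρ ^ m * s else 0) ≤ y / (1 - ρ) := by
  have h1' : 0 < 1 - ρ := by linarith
  have key : ∀ n : ℕ, ∑ m ∈ Finset.range n, (if ρ ^ m * s ≤ y then ρ ^ m * s else 0) ≤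
      (min s y - min (ρ ^ n * s) y) / (1 - ρ) := by
    intro n
    induction n with
    | zero => simp
    | succ n ih =>
      rw [Finset.sum_range_succ]
      have ha : 0 ≤ ρ ^ n * s := by positivity
      have hb : ρ ^ (n + 1) * s = ρ * (ρ ^ n * s) := by ring
      rw [hb]
      set a := ρ ^ n * s
      have step : (if a ≤ y then a else 0) ≤ (min a y - min (ρ * a) y) / (1 - ρ) := by
        rw [le_div_iff₀ h1']
        have h2 : ρ * a ≤ a := by nlinarith
        split_ifs with h
        · rw [min_eq_left h, min_eq_left (h2.trans h)]; nlinarith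
        · simpa using min_le_min_right y h2
      calc _ ≤ (min s y - min a y) / (1 - ρ) + (min a y - min (ρ * a) y) / (1 - ρ) :=
            add_le_add ih step
        _ = _ := by ring
  refine (key n).trans (div_le_div_of_nonneg_right ?_ h1'.le)
  have : 0 ≤ min (ρ ^ n * s) y := le_min (by positivity) hy
  linarith [min_le_right s y]

/-- The reciprocals grow geometrically until $\rho^ms$ drops to $y$. They are dominated by
increments of $\min((\rho^ms)^{-1},(\rho y)^{-1})$. The cap is at $(\rho y)^{-1}$ because a step
from above $y$ can land as low as $\rho y$. -/
lemma sum_inv_geometric_above_le {ρ s y : ℝ} (h0 : 0 < ρ) (h1 : ρ < 1) (hs : 0 ≤ s) (hy : 0 < y)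
    (n : ℕ) :
    ∑ m ∈ Finset.range n, (if y < ρ ^ m * s then (ρ ^ m * s)⁻¹ else 0) ≤ 1 / ((1 - ρ) * y) := by
  have h1' : 0 < 1 - ρ := by linarith
  rcases hs.eq_or_lt with rfl | hs
  · simp only [mul_zero, hy.not_gt, if_false, Finset.sum_const_zero]; positivity
  have key : ∀ n : ℕ, ∑ m ∈ Finset.range n, (if y < ρ ^ m * s then (ρ ^ m * s)⁻¹ else 0) ≤
      ρ / (1 - ρ) * (min (ρ ^ n * s)⁻¹ (ρ * y)⁻¹) := by
    intro n
    induction n with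
    | zero => simp only [Finset.range_zero, Finset.sum_empty]; positivity
    | succ n ih =>
      rw [Finset.sum_range_succ]
      have ha : 0 < ρ ^ n * s := by positivity
      have hb : ρ ^ (n + 1) * s = ρ * (ρ ^ n * s) := by ring
      rw [hb]
      set a := ρ ^ n * s
      have step : (if y < a then a⁻¹ else 0) ≤
          ρ / (1 - ρ) * (min (ρ * a)⁻¹ (ρ * y)⁻¹ - min a⁻¹ (ρ * y)⁻¹) := by
        have h2 : a⁻¹ ≤ (ρ * a)⁻¹ := inv_anti₀ (by positivity) (by nlinarith)
        split_ifs with h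
        · have h3 : (ρ * a)⁻¹ ≤ (ρ * y)⁻¹ := inv_anti₀ (by positivity) (by nlinarith)
          rw [min_eq_left h3, min_eq_left (h2.trans h3)]
          apply le_of_eq
          field_simp
        · have := min_le_min_right (ρ * y)⁻¹ h2
          exact mul_nonneg (by positivity) (by linarith)
      calc _ ≤ _ := add_le_add ih step
        _ = _ := by ring
  refine (key n).trans ?_
  calc ρ / (1 - ρ) * (min (ρ ^ n * s)⁻¹ (ρ * y)⁻¹) ≤ ρ / (1 - ρ) * (ρ * y)⁻¹ := by
        gcongr; exact min_le_right _ _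
    _ = 1 / ((1 - ρ) * y) := by field_simp

/-- This is where a logarithm enters: $\log t\le t-1$ at $t=(1+\rho a)/(1+a)$ bounds each summand by
an increment of $\log(1+\rho^ls)$. Integrated over the offspring law, it turns the $\xi\ln\xi$
condition into summability. -/
lemma sum_geometric_div_one_add_le {ρ s : ℝ} (h0 : 0 < ρ) (h1 : ρ < 1) (hs : 0 ≤ s) (n : ℕ) :
    ∑ l ∈ Finset.range n, ρ ^ l * s / (1 + ρ ^ l * s) ≤ Real.log (1 + s) / (1 - ρ) := by
  have h1' : 0 < 1 - ρ := by linarith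
  have key : ∀ n : ℕ, ∑ l ∈ Finset.range n, ρ ^ l * s / (1 + ρ ^ l * s) ≤
      (Real.log (1 + s) - Real.log (1 + ρ ^ n * s)) / (1 - ρ) := by
    intro n
    induction n with
    | zero => simp
    | succ n ih =>
      rw [Finset.sum_range_succ]
      have ha : 0 ≤ ρ ^ n * s := by positivity
      have hb : ρ ^ (n + 1) * s = ρ * (ρ ^ n * s) := by ring
      rw [hb]
      set a := ρ ^ n * s
      have hρa : 0 ≤ ρ * a := by positivity
      have step : a / (1 + a) ≤ (Real.log (1 + a) - Real.log (1 + ρ * a)) / (1 - ρ) := by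
        rw [le_div_iff₀ h1']
        have h2 := Real.log_le_sub_one_of_pos (x := (1 + ρ * a) / (1 + a)) (by positivity)
        rw [Real.log_div (by positivity) (by positivity)] at h2
        have h3 : (1 + ρ * a) / (1 + a) - 1 = - (a / (1 + a) * (1 - ρ)) := by
          field_simp; ring
        linarith
      calc _ ≤ _ := add_le_add ih step
        _ = _ := by ring
  refine (key n).trans (div_le_div_of_nonneg_right ?_ h1'.le)
  have : 0 ≤ Real.log (1 + ρ ^ n * s) := Real.log_nonneg (by linarith [show 0 ≤ ρ ^ n * s by positivity])
  linarith

/-! ### Growth of the powers of a primitive matrix -/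

section PrimitiveMatrix

open Filter Topology

variable {d : ℕ}

/-- The sum of all entries of a matrix. -/
def entrySum (A : Matrix (Fin d) (Fin d) ℝ) : ℝ := ∑ i, ∑ j, A i j

lemma matrix_pow_nonneg {A : Matrix (Fin d) (Fin d) ℝ} (hA : ∀ i j, 0 ≤ A i j) (n : ℕ) (i j : Fin d) :
    0 ≤ (A ^ n) i j := by
  induction n generalizing i j with
  | zero => simp only [pow_zero, Matrix.one_apply]; split_ifs <;> norm_num
  | succ n ih =>
    rw [pow_succ, Matrix.mul_apply]
    exact Finset.sum_nonneg fun k _ => mul_nonneg (ih i k) (hA k j)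

lemma entry_le_entrySum {A : Matrix (Fin d) (Fin d) ℝ} (hA : ∀ i j, 0 ≤ A i j) (i j : Fin d) :
    A i j ≤ entrySum A :=
  (Finset.single_le_sum (f := fun j => A i j) (fun j _ => hA i j) (Finset.mem_univ j)).trans
    (Finset.single_le_sum (f := fun i => ∑ j, A i j)
      (fun i _ => Finset.sum_nonneg fun j _ => hA i j) (Finset.mem_univ i))

/-- Every entry of $A$ is linked to every entry of $C$ through some entry of $B$. With $B=A^K>0$
this makes the entry sums of powers supermultiplicative up to a constant. -/
lemma mul_entrySum_mul_entrySum_le {A B C : Matrix (Fin d) (Fin d) ℝ} {κ : ℝ}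
    (hA : ∀ i j, 0 ≤ A i j) (hB : ∀ i j, κ ≤ B i j) (hC : ∀ i j, 0 ≤ C i j) :
    κ * (entrySum A * entrySum C) ≤ entrySum (A * B * C) := by
  have h : entrySum (A * B * C) = ∑ i, ∑ j, ∑ l, ∑ k, A i k * B k l * C l j := by
    simp only [entrySum, Matrix.mul_apply, Finset.sum_mul]
  have h' : κ * (entrySum A * entrySum C) = ∑ i, ∑ j, ∑ l, ∑ k, A i k * κ * C l j := by
    simp only [entrySum]
    rw [Finset.sum_mul, Finset.mul_sum]
    refine Finset.sum_congr rfl fun i _ => ?_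
    rw [Finset.sum_comm (f := fun l j => C l j), Finset.mul_sum, Finset.mul_sum]
    refine Finset.sum_congr rfl fun j _ => ?_
    rw [Finset.mul_sum, Finset.mul_sum]
    refine Finset.sum_congr rfl fun l _ => ?_
    rw [Finset.sum_mul, Finset.mul_sum]
    exact Finset.sum_congr rfl fun k _ => by ring
  rw [h, h']
  gcongr with i _ j _ l _ k _
  · exact hC l j
  · exact hA i k
  · exact hB k l

lemma mul_entrySum_le_mul_mul {A B : Matrix (Fin d) (Fin d) ℝ} {κ : ℝ} (hκ : 0 ≤ κ)
    (hA : ∀ i j, κ ≤ A i j) (hB : ∀ i j, 0 ≤ B i j) (i j : Fin d) :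
    κ * κ * entrySum B ≤ (A * B * A) i j := by
  simp only [Matrix.mul_apply, entrySum, Finset.sum_mul]
  rw [Finset.mul_sum, Finset.sum_comm]
  refine Finset.sum_le_sum fun k _ => ?_
  rw [Finset.mul_sum]
  refine Finset.sum_le_sum fun l _ => ?_
  have h1 : κ * B k l ≤ A i k * B k l := mul_le_mul_of_nonneg_right (hA i k) (hB k l)
  have h2 := mul_le_mul h1 (hA l j) hκ (mul_nonneg (hκ.trans (hA i k)) (hB k l))
  linarith

attribute [local instance] Matrix.linftyOpNormedRing Matrix.linftyOpNormedAlgebra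

lemma norm_map_le_entrySum {A : Matrix (Fin d) (Fin d) ℝ} (hA : ∀ i j, 0 ≤ A i j) :
    ‖A.map (algebraMap ℝ ℂ)‖ ≤ entrySum A := by
  have h0 : 0 ≤ entrySum A := Finset.sum_nonneg fun i _ => Finset.sum_nonneg fun j _ => hA i j
  rw [Matrix.linfty_opNorm_def]
  refine NNReal.coe_le_coe.2 (Finset.sup_le (a := (⟨entrySum A, h0⟩ : NNReal)) fun i _ => ?_)
  refine NNReal.coe_le_coe.1 ?_
  push_cast
  calc ∑ j, ‖A.map (algebraMap ℝ ℂ) i j‖ = ∑ j, A i j := by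
        refine Finset.sum_congr rfl fun j _ => ?_
        simp [abs_of_nonneg (hA i j)]
    _ ≤ _ := Finset.single_le_sum (f := fun i => ∑ j, A i j)
      (fun i _ => Finset.sum_nonneg fun j _ => hA i j) (Finset.mem_univ i)

lemma entrySum_le_norm_map {A : Matrix (Fin d) (Fin d) ℝ} (hA : ∀ i j, 0 ≤ A i j) :
    entrySum A ≤ d * ‖A.map (algebraMap ℝ ℂ)‖ := by
  have h : ∀ i, ∑ j, A i j ≤ ‖A.map (algebraMap ℝ ℂ)‖ := by
    intro i
    rw [Matrix.linfty_opNorm_def]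
    have := Finset.le_sup (f := fun i : Fin d => ∑ j, ‖A.map (algebraMap ℝ ℂ) i j‖₊) (Finset.mem_univ i)
    rw [← NNReal.coe_le_coe] at this
    refine le_trans (le_of_eq ?_) this
    push_cast
    refine Finset.sum_congr rfl fun j _ => ?_
    simp [abs_of_nonneg (hA i j)]
  simpa [entrySum] using Finset.sum_le_sum fun i (_ : i ∈ Finset.univ) => h i

lemma map_pow_algebraMap (A : Matrix (Fin d) (Fin d) ℝ) (n : ℕ) :
    (A ^ n).map (algebraMap ℝ ℂ) = A.map (algebraMap ℝ ℂ) ^ n :=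
  map_pow (algebraMap ℝ ℂ).mapMatrix A n

lemma specRadius_nonneg (A : Matrix (Fin d) (Fin d) ℝ) : 0 ≤ specRadius A :=
  ENNReal.toReal_nonneg

lemma spectralRadius_map_ne_top (hd : 1 ≤ d) (A : Matrix (Fin d) (Fin d) ℝ) :
    spectralRadius ℂ (A.map (algebraMap ℝ ℂ)) ≠ ∞ := by
  have : Nonempty (Fin d) := ⟨⟨0, hd⟩⟩
  have : NormOneClass (Matrix (Fin d) (Fin d) ℂ) := Matrix.linfty_opNormOneClass
  exact ((spectrum.spectralRadius_le_nnnorm (𝕜 := ℂ) _).trans_lt ENNReal.coe_lt_top).ne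

lemma specRadius_pow_le_entrySum (hd : 1 ≤ d) {A : Matrix (Fin d) (Fin d) ℝ}
    (hA : ∀ i j, 0 ≤ A i j) {n : ℕ} (hn : n ≠ 0) :
    specRadius A ^ n ≤ entrySum (A ^ n) := by
  have : Nonempty (Fin d) := ⟨⟨0, hd⟩⟩
  have : NormOneClass (Matrix (Fin d) (Fin d) ℂ) := Matrix.linfty_opNormOneClass
  have h1 := (spectrum.spectralRadius_pow_le (𝕜 := ℂ) (A.map (algebraMap ℝ ℂ)) n hn).trans
    (spectrum.spectralRadius_le_nnnorm (𝕜 := ℂ) _)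
  have h2 := ENNReal.toReal_mono ENNReal.coe_ne_top h1
  rw [ENNReal.toReal_pow] at h2
  refine h2.trans ?_
  rw [← map_pow_algebraMap]
  exact norm_map_le_entrySum (matrix_pow_nonneg hA n)

lemma le_of_forall_pow_le_mul_pow {x z D : ℝ} (hz : 0 < z)
    (h : ∀ᶠ k : ℕ in atTop, x ^ k ≤ D * z ^ k) : x ≤ z := by
  by_contra! hlt
  have h1 : Tendsto (fun k : ℕ => (x / z) ^ k) atTop atTop :=
    tendsto_pow_atTop_atTop_of_one_lt ((one_lt_div hz).2 hlt)
  obtain ⟨k, hk, hk'⟩ := (h.and (h1.eventually_gt_atTop D)).exists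
  rw [div_pow, lt_div_iff₀ (by positivity)] at hk'
  linarith

/-- Gelfand's formula bounds the entry sum of $A^{kN}$ by $d\,r^{kN}$ for large $k$ and every $r$
above the spectral radius. Taking $k$-th roots and then letting $r$ decrease removes the constant.
-/
lemma le_specRadius_pow (hd : 1 ≤ d) {A : Matrix (Fin d) (Fin d) ℝ} (hA : ∀ i j, 0 ≤ A i j)
    {N : ℕ} (hN : 0 < N) {x : ℝ} (h : ∀ k : ℕ, x ^ k ≤ entrySum (A ^ (k * N))) :
    x ≤ specRadius A ^ N := by
  have hlim := spectrum.pow_nnnorm_pow_one_div_tendsto_nhds_spectralRadius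
    (A.map (algebraMap ℝ ℂ))
  have hr : ∀ r, specRadius A < r → x ≤ r ^ N := by
    intro r hr
    have hr0 : 0 < r := (specRadius_nonneg A).trans_lt hr
    have h1 : spectralRadius ℂ (A.map (algebraMap ℝ ℂ)) < ENNReal.ofReal r :=
      (ENNReal.lt_ofReal_iff_toReal_lt (spectralRadius_map_ne_top hd A)).2 hr
    have h2 : Tendsto (fun k : ℕ => k * N) atTop atTop := tendsto_id.atTop_mul_const' hN
    refine le_of_forall_pow_le_mul_pow (D := d) (by positivity) ?_
    filter_upwards [h2.eventually (hlim.eventually_lt_const h1), eventually_gt_atTop 0] with k hk hk0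
    have hkN : (0 : ℝ) < ((k * N : ℕ) : ℝ) := by exact_mod_cast Nat.mul_pos hk0 hN
    have h3 := ENNReal.rpow_lt_rpow hk hkN
    rw [← ENNReal.rpow_mul, one_div, inv_mul_cancel₀ hkN.ne', ENNReal.rpow_one,
      ENNReal.rpow_natCast, ← ENNReal.ofReal_pow hr0.le] at h3
    have h4 : ‖A.map (algebraMap ℝ ℂ) ^ (k * N)‖ < r ^ (k * N) := by
      simpa using (ENNReal.lt_ofReal_iff_toReal_lt ENNReal.coe_ne_top).1 h3
    refine (h k).trans ((entrySum_le_norm_map (matrix_pow_nonneg hA _)).trans ?_)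
    rw [map_pow_algebraMap, ← pow_mul, mul_comm N k]
    gcongr
  have hcont : Tendsto (fun r : ℝ => r ^ N) (𝓝[>] (specRadius A)) (𝓝 (specRadius A ^ N)) :=
    ((continuous_pow N).tendsto _).mono_left nhdsWithin_le_nhds
  exact ge_of_tendsto hcont (eventually_nhdsWithin_of_forall fun r hr' => hr r hr')

/-- Two-sided Perron–Frobenius bounds for the powers of a primitive matrix. -/
theorem exists_pow_bounds (hd : 1 ≤ d) {A : Matrix (Fin d) (Fin d) ℝ} (hA : A.IsPrimitive) :
    0 < specRadius A ∧ ∃ K : ℕ, 0 < K ∧ ∃ c : ℝ, 0 < c ∧ ∃ C : ℝ, 0 < C ∧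
      (∀ n i j, (A ^ n) i j ≤ C * specRadius A ^ n) ∧
      (∀ n, K ≤ n → ∀ i j, c * specRadius A ^ n ≤ (A ^ n) i j) := by
  obtain ⟨hA0, K, hK, hpos⟩ := hA
  have : Nonempty (Fin d) := ⟨⟨0, hd⟩⟩
  obtain ⟨κ, hκ, hκA⟩ : ∃ κ : ℝ, 0 < κ ∧ ∀ i j, κ ≤ (A ^ K) i j := by
    obtain ⟨p, hp⟩ := Finite.exists_min (fun p : Fin d × Fin d => (A ^ K) p.1 p.2)
    exact ⟨_, hpos p.1 p.2, fun i j => hp (i, j)⟩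
  have hn := fun n => matrix_pow_nonneg hA0 n
  have hone : 1 ≤ entrySum (A ^ 0) := by
    have := entry_le_entrySum (hn 0) ⟨0, hd⟩ ⟨0, hd⟩
    simpa using this
  -- Supermultiplicativity shows that the $k$-th power of $\kappa\cdot$`entrySum (A ^ m)` is at most
  -- `entrySum (A ^ (k * (m + K)))`, so `le_specRadius_pow` applies.
  have hup : ∀ m, κ * entrySum (A ^ m) ≤ specRadius A ^ (m + K) := by
    intro m
    refine le_specRadius_pow hd hA0 (by omega) fun k => ?_
    have h0 : 0 ≤ κ * entrySum (A ^ m) :=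
      mul_nonneg hκ.le (Finset.sum_nonneg fun i _ => Finset.sum_nonneg fun j _ => hn m i j)
    induction k with
    | zero => simpa using hone
    | succ k ih =>
      have h1 := mul_entrySum_mul_entrySum_le (hn m) hκA (hn (k * (m + K)))
      rw [← pow_add, ← pow_add] at h1
      rw [show (k + 1) * (m + K) = m + K + k * (m + K) by ring]
      refine le_trans ?_ h1
      rw [pow_succ]
      nlinarith
  have hρ : 0 < specRadius A := by
    have h1 : 0 < specRadius A ^ (0 + K) := lt_of_lt_of_le (by nlinarith) (hup 0)
    rcases (specRadius_nonneg A).eq_or_lt with h | h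
    · rw [← h, zero_pow (by omega)] at h1; exact absurd h1 (lt_irrefl _)
    · exact h
  -- The lower bound factors $A^n=A^KA^mA^K$. It uses the bound of $\varrho^m$ by the entry sum,
  -- which is available only for $m\ne0$, hence $2K+1$ rather than $2K$.
  refine ⟨hρ, 2 * K + 1, by omega, κ * κ / specRadius A ^ (2 * K), by positivity,
    specRadius A ^ K / κ, by positivity, fun n i j => ?_, fun n hKn i j => ?_⟩
  · refine (entry_le_entrySum (hn n) i j).trans ?_
    rw [div_mul_eq_mul_div, le_div_iff₀ hκ, ← pow_add, add_comm K n, mul_comm]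
    exact hup n
  · obtain ⟨m, rfl⟩ : ∃ m, n = K + m + K := ⟨n - 2 * K, by omega⟩
    have h1 := mul_entrySum_le_mul_mul hκ.le hκA (hn m) i j
    rw [← pow_add, ← pow_add] at h1
    have h2 := specRadius_pow_le_entrySum hd hA0 (n := m) (by omega)
    refine le_trans ?_ h1
    rw [show K + m + K = 2 * K + m by ring, pow_add, div_mul_eq_mul_div, div_le_iff₀ (by positivity)]
    have : 0 < specRadius A ^ (2 * K) := by positivity
    nlinarith [mul_le_mul_of_nonneg_left h2 (mul_nonneg (mul_nonneg hκ.le hκ.le) this.le)]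

end PrimitiveMatrix

/-! ### Products of probabilities for independent identically distributed variables -/

section Products

variable {Ω : Type*} [MeasurableSpace Ω] {P : Measure Ω}

lemma lintegral_prod_comp_eq {n : ℕ} {E : Type*} [MeasurableSpace E] {T : Fin n → Ω → E}
    {T₀ : Ω → E} (hind : iIndepFun T P) (hT : ∀ m, Measurable (T m))
    (hid : ∀ m, IdentDistrib (T m) T₀ P P) {g : Fin n → E → ℝ≥0∞} (hg : ∀ m, Measurable (g m)) :
    ∫⁻ ω, ∏ m, g m (T m ω) ∂P = ∏ m, ∫⁻ ω, g m (T₀ ω) ∂P := by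
  rw [lintegral_prod_eq_prod_lintegral_of_indepFun Finset.univ (fun m ω => g m (T m ω))
    (hind.comp g hg) (fun m => (hg m).comp (hT m))]
  exact Finset.prod_congr rfl fun m _ => ((hid m).comp (hg m)).lintegral_eq

lemma measurableSet_le_const {f : Ω → ℝ} (hf : Measurable f) (a : ℝ) :
    MeasurableSet {ω | f ω ≤ a} := measurableSet_le hf measurable_const

lemma measure_setOf_le_pos_mono {T₀ : Ω → ℝ} {y ρ : ℝ} (hρ0 : 0 < ρ) (hρ1 : ρ < 1) (hy : 0 < y)
    (m : ℕ) : P {ω | T₀ ω ≤ y} ≤ P {ω | T₀ ω ≤ y * (ρ ^ m)⁻¹} := by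
  refine measure_mono fun ω (hω : T₀ ω ≤ y) => hω.trans ?_
  exact le_mul_of_one_le_right hy.le ((one_le_inv₀ (by positivity)).2 (pow_le_one₀ hρ0.le hρ1.le))

/-- Conditionally on `T m ≤ y * ρ ^ (-m)` for all `m`, the weighted sum of the `T m` is bounded in
mean, uniformly in the number of summands. -/
lemma exists_half_prod_le_measure_sum_le [IsProbabilityMeasure P] {T₀ : Ω → ℝ}
    (hT₀ : ∀ ω, 0 ≤ T₀ ω) (hmT₀ : Measurable T₀)
    {ρ y C : ℝ} (hρ0 : 0 < ρ) (hρ1 : ρ < 1) (hy : 0 < y) (hC : 0 < C)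
    (hp : 0 < P {ω | T₀ ω ≤ y}) :
    ∃ b : ℝ, 0 < b ∧ ∀ (n : ℕ) (T : Fin n → Ω → ℝ), iIndepFun T P → (∀ m, Measurable (T m)) →
      (∀ m ω, 0 ≤ T m ω) → (∀ m, IdentDistrib (T m) T₀ P P) →
      2⁻¹ * ∏ m : Fin n, P {ω | T₀ ω ≤ y * (ρ ^ (m : ℕ))⁻¹} ≤
        P {ω | ∑ m : Fin n, C * (ρ ^ (m : ℕ) * T m ω) ≤ b} := by
  have h1ρ : 0 < 1 - ρ := by linarith
  set p := P {ω | T₀ ω ≤ y} with hpdef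
  have hptop : p ≠ ∞ := measure_ne_top _ _
  -- `a` bounds the mean of the sum conditionally on all constraints: $Cy/(1-\rho)$ comes from the
  -- geometric sum below $y$, and $p^{-1}$ is the price of conditioning one variable. Markov's
  -- inequality at $2a$ then loses half.
  set a : ℝ≥0∞ := ENNReal.ofReal (C * (y / (1 - ρ))) * p⁻¹ with ha
  have ha0 : a ≠ 0 := by
    refine mul_ne_zero ?_ (ENNReal.inv_ne_zero.2 hptop)
    simpa using mul_pos hC (div_pos hy h1ρ)
  have hatop : a ≠ ∞ := ENNReal.mul_ne_top ENNReal.ofReal_ne_top (ENNReal.inv_ne_top.2 hp.ne')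
  refine ⟨2 * a.toReal, by have := ENNReal.toReal_pos ha0 hatop; positivity,
    fun n T hind hT hT0 hid => ?_⟩
  set F : Fin n → ℝ≥0∞ := fun m => P {ω | T₀ ω ≤ y * (ρ ^ (m : ℕ))⁻¹} with hF
  set E : Set Ω := {ω | ∀ m : Fin n, T m ω ≤ y * (ρ ^ (m : ℕ))⁻¹} with hE
  have hEmeas : MeasurableSet E := by
    rw [hE, Set.ofPred_forall]
    exact MeasurableSet.iInter fun m => measurableSet_le_const (hT m) _
  have hind1 : ∀ ω, E.indicator (fun _ => (1 : ℝ≥0∞)) ω =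
      ∏ m : Fin n, (Set.Iic (y * (ρ ^ (m : ℕ))⁻¹)).indicator (fun _ => (1 : ℝ≥0∞)) (T m ω) := by
    intro ω
    by_cases hω : ω ∈ E
    · rw [Set.indicator_of_mem hω, Finset.prod_eq_one]
      intro m _
      exact Set.indicator_of_mem (Set.mem_Iic.2 (hω m)) _
    · rw [Set.indicator_of_notMem hω]
      simp only [hE, Set.mem_ofPred_eq, not_forall] at hω
      obtain ⟨m, hm⟩ := hω
      exact (Finset.prod_eq_zero (Finset.mem_univ m)
        (Set.indicator_of_notMem (mt Set.mem_Iic.1 hm) _)).symm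
  have hFi : ∀ m : Fin n, ∫⁻ ω, (Set.Iic (y * (ρ ^ (m : ℕ))⁻¹)).indicator
      (fun _ => (1 : ℝ≥0∞)) (T₀ ω) ∂P = F m := by
    intro m
    have : (fun ω => (Set.Iic (y * (ρ ^ (m : ℕ))⁻¹)).indicator (fun _ => (1 : ℝ≥0∞)) (T₀ ω)) =
      {ω | T₀ ω ≤ y * (ρ ^ (m : ℕ))⁻¹}.indicator 1 := rfl
    rw [this, lintegral_indicator_one (measurableSet_le_const hmT₀ _)]
  have hPE : P E = ∏ m, F m := by
    rw [← lintegral_indicator_one hEmeas, ← Finset.prod_congr rfl fun m _ => hFi m,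
      ← lintegral_prod_comp_eq hind hT hid
        (fun m => measurable_const.indicator measurableSet_Iic)]
    exact lintegral_congr hind1
  set η : Fin n → ℝ≥0∞ := fun m => ∫⁻ ω, ENNReal.ofReal
    (if ρ ^ (m : ℕ) * T₀ ω ≤ y then C * (ρ ^ (m : ℕ) * T₀ ω) else 0) ∂P with hη
  have hηsum : ∑ m, η m ≤ ENNReal.ofReal (C * (y / (1 - ρ))) := by
    rw [hη, ← lintegral_finsetSum]
    · calc _ ≤ ∫⁻ ω, ENNReal.ofReal (C * (y / (1 - ρ))) ∂P := by
            refine lintegral_mono fun ω => ?_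
            rw [← ENNReal.ofReal_sum_of_nonneg]
            · refine ENNReal.ofReal_le_ofReal ?_
              refine le_trans (le_of_eq ?_) (mul_le_mul_of_nonneg_left
                (sum_geometric_below_le hρ0 hρ1 (hT₀ ω) hy.le n) hC.le)
              rw [← Fin.sum_univ_eq_sum_range
                (fun m => if ρ ^ m * T₀ ω ≤ y then ρ ^ m * T₀ ω else 0), Finset.mul_sum]
              exact Finset.sum_congr rfl fun m _ => by split_ifs <;> simp
            · intro m _
              have := hT₀ ω
              split_ifs <;> positivity
        _ = _ := by simp
    · intro m _
      refine (Measurable.ite (measurableSet_le (by fun_prop) measurable_const)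
        (by fun_prop) measurable_const).ennreal_ofReal
  -- By independence the restricted expectation factorises. The factor with index $m$ is `η m` in
  -- place of `F m`, and `F m` is at least $p$.
  have hterm : ∀ m : Fin n, ∫⁻ ω in E, ENNReal.ofReal (C * (ρ ^ (m : ℕ) * T m ω)) ∂P ≤
      η m * p⁻¹ * ∏ m, F m := by
    intro m
    rw [← lintegral_indicator hEmeas]
    have h1 : ∀ ω, E.indicator (fun ω => ENNReal.ofReal (C * (ρ ^ (m : ℕ) * T m ω))) ω =
        ∏ k : Fin n, ((Set.Iic (y * (ρ ^ (k : ℕ))⁻¹)).indicator (fun _ => (1 : ℝ≥0∞)) (T k ω) *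
          (if k = m then ENNReal.ofReal (C * (ρ ^ (m : ℕ) * T k ω)) else 1)) := by
      intro ω
      rw [Finset.prod_mul_distrib, ← hind1, Finset.prod_ite_eq']
      by_cases hω : ω ∈ E <;> simp [hω]
    rw [lintegral_congr h1, lintegral_prod_comp_eq (g := fun k r =>
      (Set.Iic (y * (ρ ^ (k : ℕ))⁻¹)).indicator (fun _ => (1 : ℝ≥0∞)) r *
          (if k = m then ENNReal.ofReal (C * (ρ ^ (m : ℕ) * r)) else 1)) hind hT hid]
    · rw [← Finset.mul_prod_erase _ _ (Finset.mem_univ m)]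
      have h2 : ∏ k ∈ Finset.univ.erase m, ∫⁻ ω, (Set.Iic (y * (ρ ^ (k : ℕ))⁻¹)).indicator
          (fun _ => (1 : ℝ≥0∞)) (T₀ ω) * (if k = m then ENNReal.ofReal (C * (ρ ^ (m : ℕ) * T₀ ω))
            else 1) ∂P = ∏ k ∈ Finset.univ.erase m, F k := by
        refine Finset.prod_congr rfl fun k hk => ?_
        simp only [if_neg (Finset.ne_of_mem_erase hk), mul_one]
        exact hFi k
      have h3 : ∫⁻ ω, (Set.Iic (y * (ρ ^ (m : ℕ))⁻¹)).indicator
          (fun _ => (1 : ℝ≥0∞)) (T₀ ω) * (if m = m then ENNReal.ofReal (C * (ρ ^ (m : ℕ) * T₀ ω))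
            else 1) ∂P = η m := by
        refine lintegral_congr fun ω => ?_
        have hpow : 0 < ρ ^ (m : ℕ) := by positivity
        have hiff : T₀ ω ≤ y * (ρ ^ (m : ℕ))⁻¹ ↔ ρ ^ (m : ℕ) * T₀ ω ≤ y := by
          rw [← div_eq_mul_inv, le_div_iff₀ hpow, mul_comm]
        by_cases hω : ρ ^ (m : ℕ) * T₀ ω ≤ y
        · simp [Set.indicator, hiff, hω]
        · simp [Set.indicator, hiff, hω]
      rw [h2, h3, ← Finset.mul_prod_erase _ _ (Finset.mem_univ m), mul_assoc, ← mul_assoc p⁻¹]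
      gcongr
      refine le_mul_of_one_le_left (zero_le) ?_
      rw [← ENNReal.inv_mul_cancel hp.ne' hptop]
      gcongr
      exact measure_setOf_le_pos_mono hρ0 hρ1 hy m
    · intro k
      refine (measurable_const.indicator measurableSet_Iic).mul ?_
      split_ifs <;> fun_prop
  have hint : ∫⁻ ω in E, ∑ m : Fin n, ENNReal.ofReal (C * (ρ ^ (m : ℕ) * T m ω)) ∂P ≤
      a * P E := by
    rw [lintegral_finsetSum _ (fun m _ => by fun_prop), hPE]
    calc _ ≤ ∑ m, η m * p⁻¹ * ∏ m, F m := Finset.sum_le_sum fun m _ => hterm m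
      _ = (∑ m, η m) * p⁻¹ * ∏ m, F m := by rw [Finset.sum_mul, Finset.sum_mul]
      _ ≤ _ := by rw [ha]; gcongr
  set B : Set Ω := {ω | ∑ m : Fin n, C * (ρ ^ (m : ℕ) * T m ω) ≤ 2 * a.toReal} with hB
  have hBmeas : MeasurableSet B := measurableSet_le (by fun_prop) measurable_const
  have hbad : P (E \ B) ≤ 2⁻¹ * P E := by
    have h1 := mul_meas_ge_le_lintegral₀ (μ := P.restrict E) (f := fun ω => ∑ m : Fin n,
      ENNReal.ofReal (C * (ρ ^ (m : ℕ) * T m ω))) (by fun_prop) (2 * a)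
    have h2 : P (E \ B) ≤ P.restrict E {ω | 2 * a ≤ ∑ m : Fin n,
        ENNReal.ofReal (C * (ρ ^ (m : ℕ) * T m ω))} := by
      rw [Measure.restrict_apply' hEmeas]
      refine measure_mono fun ω hω => ⟨?_, hω.1⟩
      have h3 : 2 * a.toReal < ∑ m : Fin n, C * (ρ ^ (m : ℕ) * T m ω) := by simpa [hB] using hω.2
      have h4 : 2 * a = ENNReal.ofReal (2 * a.toReal) := by
        rw [ENNReal.ofReal_mul zero_le_two, ENNReal.ofReal_toReal hatop]; simp
      rw [Set.mem_ofPred_eq, h4, ← ENNReal.ofReal_sum_of_nonneg]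
      · exact ENNReal.ofReal_le_ofReal h3.le
      · intro m _
        have := hT0 m ω
        positivity
    have h5 : (2 * a) * P (E \ B) ≤ a * P E := (mul_le_mul_right h2 _).trans (h1.trans hint)
    rw [mul_comm 2 a, mul_assoc, ENNReal.mul_le_mul_iff_right ha0 hatop] at h5
    calc P (E \ B) = 2⁻¹ * (2 * P (E \ B)) := by
          rw [← mul_assoc, ENNReal.inv_mul_cancel (by norm_num) (by norm_num), one_mul]
      _ ≤ _ := by gcongr
  have hsplit : P E ≤ P (E ∩ B) + P (E \ B) := (measure_inter_add_sdiff E hBmeas).ge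
  have hhalf : 2⁻¹ * P E ≤ P (E ∩ B) := by
    have h1 : P E = 2⁻¹ * P E + 2⁻¹ * P E := by rw [← add_mul, ENNReal.inv_two_add_inv_two, one_mul]
    have h2 : 2⁻¹ * P E + 2⁻¹ * P E ≤ P (E ∩ B) + 2⁻¹ * P E := by
      rw [← h1]; exact hsplit.trans (by gcongr)
    exact (ENNReal.add_le_add_iff_right
      (ENNReal.mul_ne_top (by norm_num) (measure_ne_top _ _))).1 h2
  rw [← hPE]
  exact hhalf.trans (measure_mono Set.inter_subset_right)

lemma prod_one_add_le_exp {x : ℕ → ℝ≥0∞} {n : ℕ} {S : ℝ≥0∞} (hS : S ≠ ∞)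
    (h : ∑ m ∈ Finset.range n, x m ≤ S) :
    ∏ m ∈ Finset.range n, (1 + x m) ≤ ENNReal.ofReal (Real.exp S.toReal) := by
  have hx : ∀ m ∈ Finset.range n, x m ≠ ∞ := fun m hm =>
    ((Finset.single_le_sum (fun _ _ => zero_le) hm).trans h |>.trans_lt hS.lt_top).ne
  calc ∏ m ∈ Finset.range n, (1 + x m) ≤
        ∏ m ∈ Finset.range n, ENNReal.ofReal (Real.exp (x m).toReal) := by
        refine Finset.prod_le_prod' fun m hm => ?_
        conv_lhs => rw [← ENNReal.ofReal_toReal (hx m hm), ← ENNReal.ofReal_one,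
          ← ENNReal.ofReal_add zero_le_one ENNReal.toReal_nonneg]
        refine ENNReal.ofReal_le_ofReal ?_
        linarith [Real.add_one_le_exp (x m).toReal]
    _ = ENNReal.ofReal (Real.exp (∑ m ∈ Finset.range n, x m).toReal) := by
        rw [← ENNReal.ofReal_prod_of_nonneg fun _ _ => (Real.exp_pos _).le, ← Real.exp_sum,
          ENNReal.toReal_sum hx]
    _ ≤ _ := ENNReal.ofReal_le_ofReal (Real.exp_le_exp.2 (ENNReal.toReal_mono hS h))

/-- Functions of `T₀` which decay like the inverse of `ρ ^ m * T₀` beyond the level `y` have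
expectations that are comparable, in the product, to `P[T₀ ≤ y * ρ ^ (-m)]`. -/
lemma exists_prod_lintegral_le [IsProbabilityMeasure P] {T₀ : Ω → ℝ}
    (hT₀ : ∀ ω, 0 ≤ T₀ ω) (hmT₀ : Measurable T₀)
    {ρ y D : ℝ} (hρ0 : 0 < ρ) (hρ1 : ρ < 1) (hy : 0 < y) (hD : 0 ≤ D)
    (hp : 0 < P {ω | T₀ ω ≤ y}) (K : ℕ) :
    ∃ C : ℝ≥0∞, C ≠ ∞ ∧ ∀ h : ℕ → ℝ → ℝ≥0∞, (∀ m r, h m r ≤ 1) →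
      (∀ m r, K ≤ m → y < ρ ^ m * r → h m r ≤ ENNReal.ofReal (D * (ρ ^ m * r)⁻¹)) →
      ∀ n, ∏ m ∈ Finset.range n, ∫⁻ ω, h m (T₀ ω) ∂P ≤
        C * ∏ m ∈ Finset.range n, P {ω | T₀ ω ≤ y * (ρ ^ m)⁻¹} := by
  have h1ρ : 0 < 1 - ρ := by linarith
  set p := P {ω | T₀ ω ≤ y} with hpdef
  have hptop : p ≠ ∞ := measure_ne_top _ _
  set F : ℕ → ℝ≥0∞ := fun m => P {ω | T₀ ω ≤ y * (ρ ^ m)⁻¹} with hF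
  set ε : ℕ → ℝ≥0∞ := fun m => ∫⁻ ω, ENNReal.ofReal
    (D * if y < ρ ^ m * T₀ ω then (ρ ^ m * T₀ ω)⁻¹ else 0) ∂P with hε
  have hεm : ∀ m, Measurable fun ω => ENNReal.ofReal
      (D * if y < ρ ^ m * T₀ ω then (ρ ^ m * T₀ ω)⁻¹ else 0) := fun m =>
    (measurable_const.mul (Measurable.ite (measurableSet_lt measurable_const (by fun_prop))
        (by fun_prop) measurable_const)).ennreal_ofReal
  -- `ε m` is the excess of the expectation over `F m` coming from values above the level, and the
  -- first $K$ indices are given excess 1. Dividing by $p\le$ `F m` makes the excess relative, so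
  -- that the product gains at most $\prod(1+x_m)\le e^S$.
  set x : ℕ → ℝ≥0∞ := fun m => (ε m + if m < K then 1 else 0) * p⁻¹ with hx
  set S : ℝ≥0∞ := (ENNReal.ofReal (D * (1 / ((1 - ρ) * y))) + K) * p⁻¹ with hS
  have hStop : S ≠ ∞ := ENNReal.mul_ne_top
    (ENNReal.add_ne_top.2 ⟨ENNReal.ofReal_ne_top, ENNReal.natCast_ne_top K⟩)
    (ENNReal.inv_ne_top.2 hp.ne')
  have hsum : ∀ n, ∑ m ∈ Finset.range n, x m ≤ S := by
    intro n
    rw [hx, ← Finset.sum_mul, Finset.sum_add_distrib]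
    refine mul_le_mul_left (add_le_add ?_ ?_) _
    · rw [hε, ← lintegral_finsetSum _ (fun m _ => hεm m)]
      calc _ ≤ ∫⁻ ω, ENNReal.ofReal (D * (1 / ((1 - ρ) * y))) ∂P := by
            refine lintegral_mono fun ω => ?_
            rw [← ENNReal.ofReal_sum_of_nonneg, ← Finset.mul_sum]
            · exact ENNReal.ofReal_le_ofReal (mul_le_mul_of_nonneg_left
                (sum_inv_geometric_above_le hρ0 hρ1 (hT₀ ω) hy n) hD)
            · intro m _
              have := hT₀ ω
              split_ifs <;> positivity
        _ = _ := by simp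
    · rw [Finset.sum_boole]
      have : (Finset.range n).filter (· < K) ⊆ Finset.range K := fun m hm => by
        simp at hm ⊢; exact hm.2
      exact_mod_cast (Finset.card_le_card this).trans (Finset.card_range K).le
  refine ⟨ENNReal.ofReal (Real.exp S.toReal), ENNReal.ofReal_ne_top, fun h h1 h2 n => ?_⟩
  have hpF : ∀ m, p ≤ F m := measure_setOf_le_pos_mono hρ0 hρ1 hy
  have hterm : ∀ m, ∫⁻ ω, h m (T₀ ω) ∂P ≤ (1 + x m) * F m := by
    intro m
    have h3 : ∫⁻ ω, h m (T₀ ω) ∂P ≤ F m + (ε m + if m < K then 1 else 0) := by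
      by_cases hm : m < K
      · calc _ ≤ ∫⁻ ω, 1 ∂P := lintegral_mono fun ω => h1 m _
          _ = 1 := by simp
          _ ≤ _ := by rw [if_pos hm, ← add_assoc]; exact le_add_self
      · rw [if_neg hm, add_zero]
        have hFm : F m = ∫⁻ ω, {ω | T₀ ω ≤ y * (ρ ^ m)⁻¹}.indicator 1 ω ∂P :=
          (lintegral_indicator_one (measurableSet_le_const hmT₀ _)).symm
        rw [hFm, hε, ← lintegral_add_right _ (hεm m)]
        refine lintegral_mono fun ω => ?_
        have hpow : 0 < ρ ^ m := by positivity
        have hiff : T₀ ω ≤ y * (ρ ^ m)⁻¹ ↔ ρ ^ m * T₀ ω ≤ y := by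
          rw [← div_eq_mul_inv, le_div_iff₀ hpow, mul_comm]
        rcases le_or_gt (ρ ^ m * T₀ ω) y with hω | hω
        · refine (h1 m _).trans (le_add_of_le_left ?_)
          rw [Set.indicator_of_mem (show ω ∈ {ω | T₀ ω ≤ y * (ρ ^ m)⁻¹} from hiff.2 hω)]
          rfl
        · refine (h2 m _ (by omega) hω).trans (le_add_of_le_right ?_)
          rw [if_pos hω]
    refine h3.trans ?_
    rw [add_mul, one_mul, hx]
    gcongr
    rw [mul_assoc]
    refine le_mul_of_one_le_right (zero_le) ?_
    rw [← ENNReal.inv_mul_cancel hp.ne' hptop]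
    gcongr
    exact hpF m
  calc _ ≤ ∏ m ∈ Finset.range n, ((1 + x m) * F m) := Finset.prod_le_prod' fun m _ => hterm m
    _ ≤ _ := by
        rw [Finset.prod_mul_distrib]
        gcongr
        exact prod_one_add_le_exp hStop (hsum n)

end Products

/-! ### Autoregressive and max-autoregressive processes with a constant coefficient matrix -/

section Pathwise

variable {Ω : Type*} {d : ℕ} {A : ℕ → Ω → Matrix (Fin d) (Fin d) ℝ}
  {A₀ : Matrix (Fin d) (Fin d) ℝ} {Y : ℕ → Ω → Fin d → ℝ} {ω : Ω}

lemma mulVec_mono {B : Matrix (Fin d) (Fin d) ℝ} (hB : ∀ i j, 0 ≤ B i j) {v w : Fin d → ℝ}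
    (h : v ≤ w) : B *ᵥ v ≤ B *ᵥ w := by
  intro i
  simp only [Matrix.mulVec, dotProduct]
  exact Finset.sum_le_sum fun j _ => mul_le_mul_of_nonneg_left (h j) (hB i j)

lemma mulVec_nonneg {B : Matrix (Fin d) (Fin d) ℝ} (hB : ∀ i j, 0 ≤ B i j) {v : Fin d → ℝ}
    (h : 0 ≤ v) : 0 ≤ B *ᵥ v := by
  intro i
  simp only [Matrix.mulVec, dotProduct]
  exact Finset.sum_nonneg fun j _ => mul_nonneg (hB i j) (h j)

lemma le_norm_apply {v : Fin d → ℝ} (i : Fin d) : v i ≤ ‖v‖ :=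
  (Real.le_norm_self _).trans (norm_le_pi_norm v i)

lemma norm_mono {v w : Fin d → ℝ} (hv : 0 ≤ v) (h : v ≤ w) : ‖v‖ ≤ ‖w‖ := by
  refine (pi_norm_le_iff_of_nonneg (norm_nonneg _)).2 fun i => ?_
  rw [Real.norm_of_nonneg (hv i)]
  exact (h i).trans (le_norm_apply i)

lemma norm_mulVec_le {B : Matrix (Fin d) (Fin d) ℝ} {c : ℝ} (hB : ∀ i j, 0 ≤ B i j)
    (hc : 0 ≤ c) (hBc : ∀ i j, B i j ≤ c) {v : Fin d → ℝ} (hv : 0 ≤ v) :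
    ‖B *ᵥ v‖ ≤ d * (c * ‖v‖) := by
  refine (pi_norm_le_iff_of_nonneg (by positivity)).2 fun i => ?_
  rw [Real.norm_of_nonneg (mulVec_nonneg hB hv i)]
  calc (B *ᵥ v) i = ∑ j, B i j * v j := rfl
    _ ≤ ∑ _j : Fin d, c * ‖v‖ := Finset.sum_le_sum fun j _ =>
        mul_le_mul (hBc i j) (le_norm_apply j) (hv j) hc
    _ = _ := by simp

lemma exists_apply_eq_norm (hd : 1 ≤ d) {v : Fin d → ℝ} (hv : 0 ≤ v) : ∃ j, v j = ‖v‖ := by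
  have : Nonempty (Fin d) := ⟨⟨0, hd⟩⟩
  obtain ⟨j, hj⟩ := Finite.exists_max v
  refine ⟨j, le_antisymm (le_norm_apply j) ?_⟩
  refine (pi_norm_le_iff_of_nonneg (hv j)).2 fun i => ?_
  rw [Real.norm_of_nonneg (hv i)]
  exact hj i

lemma mul_norm_le_mulVec (hd : 1 ≤ d) {B : Matrix (Fin d) (Fin d) ℝ} {c : ℝ} (hc : 0 ≤ c)
    (hB : ∀ i j, c ≤ B i j) {v : Fin d → ℝ} (hv : 0 ≤ v) (i : Fin d) :
    c * ‖v‖ ≤ (B *ᵥ v) i := by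
  obtain ⟨j, hj⟩ := exists_apply_eq_norm hd hv
  rw [← hj]
  exact (mul_le_mul_of_nonneg_right (hB i j) (hv j)).trans
    (Finset.single_le_sum (f := fun j => B i j * v j)
      (fun k _ => mul_nonneg (hc.trans (hB i k)) (hv k)) (Finset.mem_univ j))

lemma fromZero_zero : fromZero Y 0 ω = 0 := by simp [fromZero]

lemma fromZero_of_ne_zero {n : ℕ} (hn : n ≠ 0) : fromZero Y n = Y n := by
  simp [fromZero, hn]

lemma fromZero_nonneg (hY : ∀ n ω, 0 ≤ Y n ω) (n : ℕ) (ω : Ω) : 0 ≤ fromZero Y n ω := by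
  rcases eq_or_ne n 0 with rfl | hn
  · rw [fromZero_zero]
  · rw [fromZero_of_ne_zero hn]; exact hY n ω

lemma arProcess_eq_sum (hA : ∀ n, 1 ≤ n → A n ω = A₀) (n : ℕ) :
    arProcess A Y n ω = ∑ m ∈ Finset.range (n + 1), A₀ ^ m *ᵥ Y (n - m) ω := by
  induction n with
  | zero => simp [arProcess]
  | succ n ih =>
    simp only [arProcess]
    rw [hA _ (Nat.le_add_left 1 n), ih, Finset.sum_range_succ' _ (n + 1), Matrix.mulVec_sum]
    simp [pow_succ', Matrix.mulVec_mulVec]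

lemma arProcess_fromZero_eq_sum (hA : ∀ n, 1 ≤ n → A n ω = A₀) (n : ℕ) :
    arProcess A (fromZero Y) n ω = ∑ m ∈ Finset.range n, A₀ ^ m *ᵥ Y (n - m) ω := by
  rw [arProcess_eq_sum hA, Finset.sum_range_succ, Nat.sub_self, fromZero_zero, Matrix.mulVec_zero,
    add_zero]
  refine Finset.sum_congr rfl fun m hm => ?_
  rw [fromZero_of_ne_zero]
  have := Finset.mem_range.1 hm
  omega

/-- In dimension above one only this inequality is available in general: a matrix need not commute
with the coordinatewise maximum, so $M_n$ can exceed the maximum of the $A^mY_{n-m}$. -/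
lemma pow_mulVec_le_maxArProcess (hA₀ : ∀ i j, 0 ≤ A₀ i j) (hA : ∀ n, 1 ≤ n → A n ω = A₀)
    {m n : ℕ} (hmn : m ≤ n) : A₀ ^ m *ᵥ Y (n - m) ω ≤ maxArProcess A Y n ω := by
  induction m generalizing n with
  | zero => cases n <;> simp [maxArProcess]
  | succ m ih =>
    obtain ⟨n, rfl⟩ : ∃ k, n = k + 1 := ⟨n - 1, by omega⟩
    simp only [maxArProcess]
    rw [hA _ (Nat.le_add_left 1 n), pow_succ', ← Matrix.mulVec_mulVec, Nat.add_sub_add_right]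
    exact (mulVec_mono hA₀ (ih (by omega))).trans le_sup_left

lemma maxArProcess_nonneg (hY : ∀ n ω, 0 ≤ Y n ω) (n : ℕ) : 0 ≤ maxArProcess A Y n ω := by
  cases n with
  | zero => exact hY 0 ω
  | succ n => exact (hY (n + 1) ω).trans le_sup_right

lemma maxArProcess_le_arProcess (hA₀ : ∀ i j, 0 ≤ A₀ i j) (hA : ∀ n, 1 ≤ n → A n ω = A₀)
    (hY : ∀ n ω, 0 ≤ Y n ω) (n : ℕ) : maxArProcess A Y n ω ≤ arProcess A Y n ω := by
  induction n with
  | zero => exact le_rfl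
  | succ n ih =>
    simp only [maxArProcess, arProcess]
    rw [hA _ (Nat.le_add_left 1 n)]
    have h1 := mulVec_mono hA₀ ih
    refine sup_le (h1.trans (le_add_of_nonneg_right (hY _ _))) (le_add_of_nonneg_left ?_)
    exact (mulVec_nonneg hA₀ (maxArProcess_nonneg hY n)).trans h1

end Pathwise

/-! ### Recurrence of the autoregressive processes and the criterion -/

section Recurrence

variable {Ω : Type*} [MeasurableSpace Ω] {P : Measure Ω} {d : ℕ}

lemma RecurrentFromZero.of_le_const_mul {V : ℕ → Ω → Fin d → ℝ} {q : ℕ → ℝ≥0∞} {b : ℝ} {c : ℝ≥0∞}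
    (hirr : IrreducibleFromZero P V) (hb : 0 < b) (hc : c ≠ 0)
    (h : ∀ n, c * q n ≤ P {ω | ‖V n ω‖ ≤ b}) (hq : ∑' n, q n = ∞) : RecurrentFromZero P V := by
  refine ⟨hirr, b, hb, ?_⟩
  rw [eq_top_iff]
  calc ∞ = c * ∑' n, q n := by rw [hq, ENNReal.mul_top hc]
    _ = ∑' n, c * q n := ENNReal.tsum_mul_left.symm
    _ ≤ _ := ENNReal.tsum_le_tsum h

lemma tsum_eq_top_of_le_const_mul {p q : ℕ → ℝ≥0∞} {C : ℝ≥0∞} (hC : C ≠ ∞)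
    (h : ∀ n, p n ≤ C * q n) (hp : ∑' n, p n = ∞) : ∑' n, q n = ∞ := by
  by_contra hq
  have h1 : ∑' n, p n ≤ C * ∑' n, q n := by
    rw [← ENNReal.tsum_mul_left]; exact ENNReal.tsum_le_tsum h
  exact (h1.trans_lt (ENNReal.mul_lt_top hC.lt_top (lt_top_iff_ne_top.2 hq))).ne hp

/-- The shift adds the empty product 1, which does not affect divergence, and matches the $n$
innovations $Y_1,\dots,Y_n$ seen by a chain started at 0. -/
lemma criterionDiverges_iff [IsProbabilityMeasure P] {Y : ℕ → Ω → Fin d → ℝ} {y ρ : ℝ} :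
    CriterionDiverges P Y y ρ ↔
      ∑' n : ℕ, ∏ m ∈ Finset.range n, P {ω | ‖Y 1 ω‖ ≤ y * (ρ ^ m)⁻¹} = ∞ := by
  rw [CriterionDiverges, tsum_eq_zero_add' (f := fun n : ℕ => ∏ m ∈ Finset.range n,
    P {ω | ‖Y 1 ω‖ ≤ y * (ρ ^ m)⁻¹}) ENNReal.summable]
  simp

variable {Y : ℕ → Ω → Fin d → ℝ}

lemma iIndepFun_rev (hY_indep : iIndepFun Y P) (n : ℕ) :
    iIndepFun (fun (m : Fin n) => Y (n - m)) P := by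
  refine hY_indep.precomp (g := fun m : Fin n => n - (m : ℕ)) fun a b hab => ?_
  have := a.2
  have := b.2
  simp only at hab
  omega

variable {A : ℕ → Ω → Matrix (Fin d) (Fin d) ℝ} {A₀ : Matrix (Fin d) (Fin d) ℝ}

/-- One large innovation at time 1 suffices: after $K$ further steps $A^K>0$ has spread it to all
coordinates. -/
lemma maxArProcess_irreducible (hd : 1 ≤ d) (hY_nonneg : ∀ n ω, 0 ≤ Y n ω)
    (hY_unbdd : ∀ r : ℝ, 0 < P {ω | r < ‖Y 1 ω‖}) (hA₀ : A₀.IsPrimitive)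
    (hA : ∀ᵐ ω ∂P, ∀ n, 1 ≤ n → A n ω = A₀) :
    IrreducibleFromZero P (maxArProcess A (fromZero Y)) := by
  intro x hx
  obtain ⟨hρ, K, hK, c, hc, C, hC, hup, hlo⟩ := exists_pow_bounds hd hA₀
  refine ⟨K + 1, (hY_unbdd (‖x‖ / (c * specRadius A₀ ^ K))).trans_le (measure_mono_ae ?_)⟩
  filter_upwards [hA] with ω hω (hlt : _ < _)
  rw [div_lt_iff₀' (by positivity)] at hlt
  have h1 := pow_mulVec_le_maxArProcess (Y := fromZero Y) hA₀.nonneg hω (Nat.le_succ K)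
  rw [Nat.succ_eq_add_one, Nat.add_sub_cancel_left, fromZero_of_ne_zero one_ne_zero] at h1
  intro i
  have h2 := mul_norm_le_mulVec hd (by positivity) (hlo K le_rfl) (hY_nonneg 1 ω) i
  exact (le_norm_apply i).trans (hlt.le.trans (h2.trans (h1 i)))

lemma arProcess_irreducible (hd : 1 ≤ d) (hY_nonneg : ∀ n ω, 0 ≤ Y n ω)
    (hY_unbdd : ∀ r : ℝ, 0 < P {ω | r < ‖Y 1 ω‖}) (hA₀ : A₀.IsPrimitive)
    (hA : ∀ᵐ ω ∂P, ∀ n, 1 ≤ n → A n ω = A₀) :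
    IrreducibleFromZero P (arProcess A (fromZero Y)) := by
  intro x hx
  obtain ⟨n, hn⟩ := maxArProcess_irreducible hd hY_nonneg hY_unbdd hA₀ hA x hx
  refine ⟨n, hn.trans_le (measure_mono_ae ?_)⟩
  filter_upwards [hA] with ω hω (hle : _ ≤ _)
  exact hle.trans (maxArProcess_le_arProcess hA₀.nonneg hω (fromZero_nonneg hY_nonneg) n)

lemma maxARRecurrent_of_arRecurrent (hd : 1 ≤ d) (hY_nonneg : ∀ n ω, 0 ≤ Y n ω)
    (hY_unbdd : ∀ r : ℝ, 0 < P {ω | r < ‖Y 1 ω‖}) (hA₀ : A₀.IsPrimitive)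
    (hA : ∀ᵐ ω ∂P, ∀ n, 1 ≤ n → A n ω = A₀) (h : ARRecurrent P A Y) : MaxARRecurrent P A Y := by
  obtain ⟨-, b, hb, hsum⟩ := h
  refine RecurrentFromZero.of_le_const_mul (c := 1)
    (maxArProcess_irreducible hd hY_nonneg hY_unbdd hA₀ hA) hb one_ne_zero (fun n => ?_) hsum
  rw [one_mul]
  refine measure_mono_ae ?_
  filter_upwards [hA] with ω hω (hle : _ ≤ _)
  exact (norm_mono (maxArProcess_nonneg (fromZero_nonneg hY_nonneg) n)
    (maxArProcess_le_arProcess hA₀.nonneg hω (fromZero_nonneg hY_nonneg) n)).trans hle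

variable [IsProbabilityMeasure P]

/-- The upper bound on $A^m$ gives $\|X_n\|\le\sum_m dC\varrho^m\|Y_{n-m}\|$, and this sum is
bounded with at least half the probability appearing in the criterion. -/
lemma arRecurrent_of_criterionDiverges (hd : 1 ≤ d) (hY_meas : ∀ n, Measurable (Y n))
    (hY_nonneg : ∀ n ω, 0 ≤ Y n ω) (hY_indep : iIndepFun Y P)
    (hY_ident : ∀ n, 1 ≤ n → IdentDistrib (Y n) (Y 1) P P)
    (hY_unbdd : ∀ r : ℝ, 0 < P {ω | r < ‖Y 1 ω‖}) (hA₀ : A₀.IsPrimitive)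
    (hρ : specRadius A₀ < 1) (hA : ∀ᵐ ω ∂P, ∀ n, 1 ≤ n → A n ω = A₀)
    {y : ℝ} (hy : 0 < y) (hYy : 0 < P {ω | ‖Y 1 ω‖ ≤ y})
    (h : CriterionDiverges P Y y (specRadius A₀)) : ARRecurrent P A Y := by
  rw [criterionDiverges_iff] at h
  obtain ⟨hρ0, K, hK, c, hc, C, hC, hup, hlo⟩ := exists_pow_bounds hd hA₀
  have hdpos : (0 : ℝ) < d := by exact_mod_cast hd
  obtain ⟨b, hb, hbound⟩ := exists_half_prod_le_measure_sum_le (P := P) (T₀ := fun ω => ‖Y 1 ω‖)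
    (fun ω => norm_nonneg _) (hY_meas 1).norm hρ0 hρ hy (C := d * C) (by positivity) hYy
  refine RecurrentFromZero.of_le_const_mul (c := 2⁻¹)
    (arProcess_irreducible hd hY_nonneg hY_unbdd hA₀ hA) hb (by norm_num) (fun n => ?_) h
  have h1 := hbound n (fun m ω => ‖Y (n - m) ω‖)
    ((iIndepFun_rev hY_indep n).comp (fun _ v => ‖v‖) fun _ => measurable_norm)
    (fun m => (hY_meas _).norm) (fun m ω => norm_nonneg _)
    (fun m => (hY_ident _ (by have := m.2; omega)).comp measurable_norm)
  rw [Fin.prod_univ_eq_prod_range (fun m => P {ω | ‖Y 1 ω‖ ≤ y * (specRadius A₀ ^ m)⁻¹})] at h1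
  refine h1.trans (measure_mono_ae ?_)
  filter_upwards [hA] with ω hω (hle : _ ≤ _)
  change ‖(arProcess A (fromZero Y) n ω)‖ ≤ b
  rw [arProcess_fromZero_eq_sum hω]
  refine (norm_sum_le _ _).trans (le_trans ?_ hle)
  rw [← Fin.sum_univ_eq_sum_range (fun m => ‖A₀ ^ m *ᵥ Y (n - m) ω‖)]
  refine Finset.sum_le_sum fun m _ => ?_
  refine (norm_mulVec_le (matrix_pow_nonneg hA₀.nonneg m) (by positivity) (hup m)
    (hY_nonneg _ ω)).trans (le_of_eq (by ring))

/-- If, up to a constant, the probabilities of boundedness are at most products of expectations of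
functions of the innovations which decay fast enough, then divergence of their sum implies the
criterion. -/
lemma criterionDiverges_of_le_lintegral_prod (hY_meas : ∀ n, Measurable (Y n))
    (hY_indep : iIndepFun Y P) (hY_ident : ∀ n, 1 ≤ n → IdentDistrib (Y n) (Y 1) P P)
    {y ρ D : ℝ} (hρ0 : 0 < ρ) (hρ : ρ < 1) (hy : 0 < y) (hYy : 0 < P {ω | ‖Y 1 ω‖ ≤ y})
    (hD : 0 ≤ D) {K : ℕ} {h : ℕ → ℝ → ℝ≥0∞} (hm : ∀ m, Measurable (h m)) (h1 : ∀ m r, h m r ≤ 1)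
    (h2 : ∀ m r, K ≤ m → y < ρ ^ m * r → h m r ≤ ENNReal.ofReal (D * (ρ ^ m * r)⁻¹))
    {p : ℕ → ℝ≥0∞} {C : ℝ≥0∞} (hC : C ≠ ∞)
    (hp : ∀ n, p n ≤ C * ∫⁻ ω, ∏ m : Fin n, h m ‖Y (n - m) ω‖ ∂P) (hsum : ∑' n, p n = ∞) :
    CriterionDiverges P Y y ρ := by
  rw [criterionDiverges_iff]
  obtain ⟨C', hC', hbound⟩ := exists_prod_lintegral_le (P := P) (T₀ := fun ω => ‖Y 1 ω‖)
    (fun ω => norm_nonneg _) (hY_meas 1).norm hρ0 hρ hy hD hYy K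
  refine tsum_eq_top_of_le_const_mul (ENNReal.mul_ne_top hC hC') (fun n => (hp n).trans ?_) hsum
  rw [lintegral_prod_comp_eq (T₀ := fun ω => ‖Y 1 ω‖) (T := fun (m : Fin n) ω => ‖Y (n - m) ω‖)
    (g := fun m => h m) ((iIndepFun_rev hY_indep n).comp (fun _ v => ‖v‖) fun _ => measurable_norm)
    (fun m => (hY_meas _).norm)
    (fun m => (hY_ident _ (by have := m.2; omega)).comp measurable_norm) (fun m => hm m),
    Fin.prod_univ_eq_prod_range (fun m => ∫⁻ ω, h m ‖Y 1 ω‖ ∂P), mul_assoc]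
  gcongr
  exact hbound h h1 h2 n

/-- If $\|M_n\|\le b$, the lower bound on $A^m$ forces $c\varrho^m\|Y_{n-m}\|\le b$ for all $m\ge
K$. The indicator of this event is at most $(b/c)(\varrho^m\|Y_{n-m}\|)^{-1}$ wherever
$\varrho^m\|Y_{n-m}\|>y$, so the comparison of products replaces the level $b/c$ by $y$. -/
lemma criterionDiverges_of_maxARRecurrent (hd : 1 ≤ d) (hY_meas : ∀ n, Measurable (Y n))
    (hY_nonneg : ∀ n ω, 0 ≤ Y n ω) (hY_indep : iIndepFun Y P)
    (hY_ident : ∀ n, 1 ≤ n → IdentDistrib (Y n) (Y 1) P P) (hA₀ : A₀.IsPrimitive)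
    (hρ : specRadius A₀ < 1) (hA : ∀ᵐ ω ∂P, ∀ n, 1 ≤ n → A n ω = A₀)
    {y : ℝ} (hy : 0 < y) (hYy : 0 < P {ω | ‖Y 1 ω‖ ≤ y}) (h : MaxARRecurrent P A Y) :
    CriterionDiverges P Y y (specRadius A₀) := by
  obtain ⟨-, b, hb, hsum⟩ := h
  obtain ⟨hρ0, K, hK, c, hc, C, hC, hup, hlo⟩ := exists_pow_bounds hd hA₀
  set ρ := specRadius A₀
  refine criterionDiverges_of_le_lintegral_prod hY_meas hY_indep hY_ident hρ0 hρ hy hYy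
    (D := b / c) (by positivity) (K := K) (C := 1)
    (h := fun m r => if K ≤ m → c * ρ ^ m * r ≤ b then 1 else 0) (fun m => ?_) (fun m r => ?_)
    (fun m r hm hr => ?_) ENNReal.one_ne_top (fun n => ?_) hsum
  · refine Measurable.ite ?_ measurable_const measurable_const
    by_cases hm : K ≤ m
    · simpa [hm] using measurableSet_le (by fun_prop) measurable_const
    · simp [hm]
  · split_ifs <;> simp
  · split_ifs with hle
    · have hpos : 0 < ρ ^ m * r := hy.trans hr
      rw [← ENNReal.ofReal_one]
      refine ENNReal.ofReal_le_ofReal ?_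
      rw [← div_eq_mul_inv, one_le_div hpos, le_div_iff₀ hc]
      linarith [hle hm]
    · exact zero_le
  · rw [one_mul]
    have hset : P {ω | ‖(maxArProcess A (fromZero Y) n ω)‖ ≤ b} ≤
        P {ω | ∀ m : Fin n, K ≤ (m : ℕ) → c * ρ ^ (m : ℕ) * ‖Y (n - m) ω‖ ≤ b} := by
      refine measure_mono_ae ?_
      filter_upwards [hA] with ω hω (hle : _ ≤ _) m hm
      have h1 := pow_mulVec_le_maxArProcess (Y := fromZero Y) hA₀.nonneg hω m.2.le
      rw [fromZero_of_ne_zero (by have := m.2; omega)] at h1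
      have h2 := mul_norm_le_mulVec hd (by positivity) (hlo m hm) (hY_nonneg (n - m) ω) ⟨0, hd⟩
      exact h2.trans ((h1 _).trans ((le_norm_apply _).trans hle))
    refine hset.trans ?_
    rw [← lintegral_indicator_one₀]
    · refine lintegral_mono fun ω => ?_
      refine Set.indicator_apply_le' (fun hω => ?_) fun _ => zero_le
      rw [Finset.prod_eq_one fun m _ => if_pos (hω m)]
      rfl
    · rw [Set.ofPred_forall]
      refine (MeasurableSet.iInter fun m => ?_).nullMeasurableSet
      by_cases hm : K ≤ (m : ℕ)
      · simp only [hm, true_imp_iff]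
        exact measurableSet_le (((hY_meas _).norm).const_mul _) measurable_const
      · simp [hm]

end Recurrence

/-! ### Log-Laplace transform of a reproduction law -/

section LogLaplace

variable {d : ℕ}

/-- The offspring vector of an individual of type `j` as a real vector. -/
def offspringVec (ψ : Reproduction d) (j : Fin d) (u : unitInterval) : Fin d → ℝ :=
  fun i => (ψ j u i : ℝ)

/-- The log-Laplace transform of a reproduction law. -/
noncomputable def logLaplace (ψ : Reproduction d) (w : Fin d → ℝ) : Fin d → ℝ :=
  fun j => -Real.log (∫ u, Real.exp (-(w ⬝ᵥ offspringVec ψ j u)))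

variable {ψ : Reproduction d}

lemma dotProduct_nonneg' {v w : Fin d → ℝ} (hv : 0 ≤ v) (hw : 0 ≤ w) : 0 ≤ v ⬝ᵥ w :=
  Finset.sum_nonneg fun i _ => mul_nonneg (hv i) (hw i)

lemma dotProduct_le_dotProduct {v v' w : Fin d → ℝ} (hv : v ≤ v') (hw : 0 ≤ w) :
    v ⬝ᵥ w ≤ v' ⬝ᵥ w :=
  Finset.sum_le_sum fun i _ => mul_le_mul_of_nonneg_right (hv i) (hw i)

lemma offspringVec_nonneg (j : Fin d) (u : unitInterval) : 0 ≤ offspringVec ψ j u :=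
  fun _ => Nat.cast_nonneg _

lemma measurable_offspringVec (hψ : ∀ j, Measurable (ψ j)) (i j : Fin d) :
    Measurable fun u => offspringVec ψ j u i :=
  measurable_from_top.comp ((measurable_pi_apply i).comp (hψ j))

lemma measurable_dotProduct_offspringVec (hψ : ∀ j, Measurable (ψ j)) (w : Fin d → ℝ) (j : Fin d) :
    Measurable fun u => w ⬝ᵥ offspringVec ψ j u :=
  Finset.measurable_sum _ fun i _ => (measurable_offspringVec hψ i j).const_mul _

lemma exp_neg_dotProduct_le_one {w : Fin d → ℝ} (hw : 0 ≤ w) (j : Fin d) (u : unitInterval) :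
    Real.exp (-(w ⬝ᵥ offspringVec ψ j u)) ≤ 1 :=
  Real.exp_le_one_iff.2 (neg_nonpos.2 (dotProduct_nonneg' hw (offspringVec_nonneg j u)))

lemma integrable_exp_neg_dotProduct (hψ : ∀ j, Measurable (ψ j)) {w : Fin d → ℝ} (hw : 0 ≤ w)
    (j : Fin d) : Integrable fun u => Real.exp (-(w ⬝ᵥ offspringVec ψ j u)) := by
  refine Integrable.of_bound
    (measurable_dotProduct_offspringVec hψ w j).neg.exp.aestronglyMeasurable 1 ?_
  refine ae_of_all _ fun u => ?_
  rw [Real.norm_of_nonneg (Real.exp_pos _).le]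
  exact exp_neg_dotProduct_le_one hw j u

lemma exp_neg_logLaplace (hψ : ∀ j, Measurable (ψ j)) {w : Fin d → ℝ} (hw : 0 ≤ w) (j : Fin d) :
    Real.exp (-logLaplace ψ w j) = ∫ u, Real.exp (-(w ⬝ᵥ offspringVec ψ j u)) := by
  rw [logLaplace, neg_neg, Real.exp_log]
  exact integral_exp_pos (integrable_exp_neg_dotProduct hψ hw j)

lemma logLaplace_nonneg (hψ : ∀ j, Measurable (ψ j)) {w : Fin d → ℝ} (hw : 0 ≤ w) :
    0 ≤ logLaplace ψ w := by
  intro j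
  have h1 : Real.exp (-logLaplace ψ w j) ≤ 1 := by
    rw [exp_neg_logLaplace hψ hw]
    calc _ ≤ ∫ _u : unitInterval, (1 : ℝ) :=
          integral_mono (integrable_exp_neg_dotProduct hψ hw j) (integrable_const _)
            fun u => exp_neg_dotProduct_le_one hw j u
      _ = 1 := by simp
  simpa using Real.exp_le_one_iff.1 h1

lemma iterate_logLaplace_nonneg (hψ : ∀ j, Measurable (ψ j)) {w : Fin d → ℝ} (hw : 0 ≤ w)
    (l : ℕ) : 0 ≤ (logLaplace ψ)^[l] w := by
  induction l with
  | zero => exact hw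
  | succ l ih => rw [Function.iterate_succ_apply']; exact logLaplace_nonneg hψ ih

lemma integral_dotProduct_offspringVec (hint : ∀ i j, Integrable fun u => offspringVec ψ j u i)
    (w : Fin d → ℝ) (j : Fin d) :
    ∫ u, w ⬝ᵥ offspringVec ψ j u = (w ᵥ* meanMatrix ψ) j := by
  simp only [dotProduct, Matrix.vecMul, meanMatrix]
  rw [integral_finsetSum _ fun i _ => (hint i j).const_mul _]
  exact Finset.sum_congr rfl fun i _ => integral_const_mul _ _

lemma integrable_dotProduct_offspringVec (hint : ∀ i j, Integrable fun u => offspringVec ψ j u i)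
    (w : Fin d → ℝ) (j : Fin d) : Integrable fun u => w ⬝ᵥ offspringVec ψ j u :=
  integrable_finsetSum _ fun i _ => (hint i j).const_mul _

/-- Jensen's inequality, obtained by integrating the tangent line of $e^{-x}$ at the mean $\mu$. -/
lemma logLaplace_le_vecMul (hψ : ∀ j, Measurable (ψ j))
    (hint : ∀ i j, Integrable fun u => offspringVec ψ j u i) {w : Fin d → ℝ} (hw : 0 ≤ w) :
    logLaplace ψ w ≤ w ᵥ* meanMatrix ψ := by
  intro j
  have hI := integrable_dotProduct_offspringVec hint w j
  set μ := (w ᵥ* meanMatrix ψ) j with hμ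
  have h1 : Real.exp (-μ) ≤ Real.exp (-logLaplace ψ w j) := by
    rw [exp_neg_logLaplace hψ hw]
    have h2 : ∫ u, Real.exp (-μ) * (1 + μ - w ⬝ᵥ offspringVec ψ j u) = Real.exp (-μ) := by
      rw [integral_const_mul, integral_sub (integrable_const _) hI,
        integral_dotProduct_offspringVec hint, ← hμ]
      simp
    rw [← h2]
    refine integral_mono (((integrable_const _).sub hI).const_mul _)
      (integrable_exp_neg_dotProduct hψ hw j) fun u => ?_
    have h3 := Real.add_one_le_exp (μ - w ⬝ᵥ offspringVec ψ j u)
    calc _ ≤ Real.exp (-μ) * Real.exp (μ - w ⬝ᵥ offspringVec ψ j u) := by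
          gcongr; linarith
      _ = _ := by rw [← Real.exp_add]; congr 1; ring
  linarith [Real.exp_le_exp.1 h1]

lemma vecMul_mono {B : Matrix (Fin d) (Fin d) ℝ} (hB : ∀ i j, 0 ≤ B i j) {v w : Fin d → ℝ}
    (h : v ≤ w) : v ᵥ* B ≤ w ᵥ* B := by
  intro j
  simp only [Matrix.vecMul, dotProduct]
  exact Finset.sum_le_sum fun i _ => mul_le_mul_of_nonneg_right (h i) (hB i j)

lemma meanMatrix_nonneg (i j : Fin d) : 0 ≤ meanMatrix ψ i j :=
  integral_nonneg fun _ => Nat.cast_nonneg _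

lemma iterate_logLaplace_le_vecMul (hψ : ∀ j, Measurable (ψ j))
    (hint : ∀ i j, Integrable fun u => offspringVec ψ j u i) {w : Fin d → ℝ} (hw : 0 ≤ w) (l : ℕ) :
    (logLaplace ψ)^[l] w ≤ w ᵥ* meanMatrix ψ ^ l := by
  induction l with
  | zero => simp
  | succ l ih =>
    rw [Function.iterate_succ_apply', pow_succ, ← Matrix.vecMul_vecMul]
    exact (logLaplace_le_vecMul hψ hint (iterate_logLaplace_nonneg hψ hw l)).trans
      (vecMul_mono meanMatrix_nonneg ih)

/-- The total number of children of an individual of type `j`. -/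
def offspringTotal (ψ : Reproduction d) (j : Fin d) (u : unitInterval) : ℝ :=
  ∑ i, offspringVec ψ j u i

/-- The correction to the mean offspring numbers that bounds the deviation of the log-Laplace
transform from its linearisation for arguments of size at most `τ`. -/
noncomputable def meanDefect (ψ : Reproduction d) (τ : ℝ) (i j : Fin d) : ℝ :=
  ∫ u, offspringVec ψ j u i * (τ * offspringTotal ψ j u / (1 + τ * offspringTotal ψ j u))

lemma offspringTotal_nonneg (j : Fin d) (u : unitInterval) : 0 ≤ offspringTotal ψ j u :=
  Finset.sum_nonneg fun i _ => offspringVec_nonneg j u i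

lemma measurable_offspringTotal (hψ : ∀ j, Measurable (ψ j)) (j : Fin d) :
    Measurable (offspringTotal ψ j) :=
  Finset.measurable_sum _ fun i _ => measurable_offspringVec hψ i j

lemma div_one_add_le_one {a : ℝ} (ha : 0 ≤ a) : a / (1 + a) ≤ 1 :=
  (div_le_one (by linarith)).2 (by linarith)

lemma div_one_add_mono {a b : ℝ} (ha : 0 ≤ a) (hab : a ≤ b) : a / (1 + a) ≤ b / (1 + b) := by
  rw [div_le_div_iff₀ (by linarith) (by linarith)]
  nlinarith

lemma integrable_meanDefect (hψ : ∀ j, Measurable (ψ j))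
    (hint : ∀ i j, Integrable fun u => offspringVec ψ j u i) {τ : ℝ} (hτ : 0 ≤ τ) (i j : Fin d) :
    Integrable fun u => offspringVec ψ j u i *
      (τ * offspringTotal ψ j u / (1 + τ * offspringTotal ψ j u)) := by
  have hm := measurable_offspringTotal hψ j
  refine (hint i j).mono' ((measurable_offspringVec hψ i j).mul
    ((hm.const_mul τ).div ((hm.const_mul τ).const_add 1))).aestronglyMeasurable
    (ae_of_all _ fun u => ?_)
  have h1 : 0 ≤ τ * offspringTotal ψ j u := mul_nonneg hτ (offspringTotal_nonneg j u)
  have h2 : 0 ≤ offspringVec ψ j u i := offspringVec_nonneg j u i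
  rw [Real.norm_of_nonneg (by positivity)]
  exact mul_le_of_le_one_right h2 (div_one_add_le_one h1)

lemma meanDefect_nonneg {τ : ℝ} (hτ : 0 ≤ τ) (i j : Fin d) : 0 ≤ meanDefect ψ τ i j :=
  integral_nonneg fun u => mul_nonneg (offspringVec_nonneg j u i) (by
    have := mul_nonneg hτ (offspringTotal_nonneg (ψ := ψ) j u)
    positivity)

lemma meanDefect_le_meanMatrix (hψ : ∀ j, Measurable (ψ j))
    (hint : ∀ i j, Integrable fun u => offspringVec ψ j u i) {τ : ℝ} (hτ : 0 ≤ τ) (i j : Fin d) :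
    meanDefect ψ τ i j ≤ meanMatrix ψ i j :=
  integral_mono (integrable_meanDefect hψ hint hτ i j) (hint i j) fun u =>
    mul_le_of_le_one_right (offspringVec_nonneg j u i)
      (div_one_add_le_one (mul_nonneg hτ (offspringTotal_nonneg j u)))

/-- Combine $-\log s\ge1-s$ with $1-e^{-x}\ge x-x\cdot\frac{x}{1+x}$, where $x=w\cdot\xi$. Bounding
only the last fraction through $x\le\tau\sum_i\xi^i$ keeps the error linear in $w$, so it can be
compared with the mean matrix entry by entry. -/
lemma one_sub_mul_vecMul_le_logLaplace (hψ : ∀ j, Measurable (ψ j))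
    (hint : ∀ i j, Integrable fun u => offspringVec ψ j u i) {w : Fin d → ℝ} (hw : 0 ≤ w)
    {τ δ : ℝ} (hτ : 0 ≤ τ) (hwτ : ∀ i, w i ≤ τ)
    (hδ : ∀ i j, meanDefect ψ τ i j ≤ δ * meanMatrix ψ i j) (j : Fin d) :
    (1 - δ) * (w ᵥ* meanMatrix ψ) j ≤ logLaplace ψ w j := by
  have hE := integrable_exp_neg_dotProduct hψ hw j
  have h1 : 1 - ∫ u, Real.exp (-(w ⬝ᵥ offspringVec ψ j u)) ≤ logLaplace ψ w j := by
    rw [← exp_neg_logLaplace hψ hw]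
    linarith [Real.add_one_le_exp (-logLaplace ψ w j)]
  refine le_trans ?_ h1
  have hR : ∀ i, Integrable fun u => w i * (offspringVec ψ j u i - offspringVec ψ j u i *
      (τ * offspringTotal ψ j u / (1 + τ * offspringTotal ψ j u))) := fun i =>
    ((hint i j).sub (integrable_meanDefect hψ hint hτ i j)).const_mul _
  have h2 : ∫ u, ∑ i, w i * (offspringVec ψ j u i - offspringVec ψ j u i *
      (τ * offspringTotal ψ j u / (1 + τ * offspringTotal ψ j u))) =
      ∑ i, w i * (meanMatrix ψ i j - meanDefect ψ τ i j) := by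
    rw [integral_finsetSum _ fun i _ => hR i]
    refine Finset.sum_congr rfl fun i _ => ?_
    rw [integral_const_mul, integral_sub (hint i j) (integrable_meanDefect hψ hint hτ i j)]
    rfl
  have h3 : (1 - δ) * (w ᵥ* meanMatrix ψ) j ≤
      ∑ i, w i * (meanMatrix ψ i j - meanDefect ψ τ i j) := by
    simp only [Matrix.vecMul, dotProduct]
    rw [Finset.mul_sum]
    refine Finset.sum_le_sum fun i _ => ?_
    nlinarith [mul_le_mul_of_nonneg_left (hδ i j) (hw i)]
  refine h3.trans ?_
  rw [← h2]
  have h4 : 1 - ∫ u, Real.exp (-(w ⬝ᵥ offspringVec ψ j u)) =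
      ∫ u, (1 - Real.exp (-(w ⬝ᵥ offspringVec ψ j u))) := by
    rw [integral_sub (integrable_const _) hE]; simp
  rw [h4]
  refine integral_mono (integrable_finsetSum _ fun i _ => hR i) ((integrable_const _).sub hE)
    fun u => ?_
  set x := w ⬝ᵥ offspringVec ψ j u with hx
  set κ := τ * offspringTotal ψ j u / (1 + τ * offspringTotal ψ j u) with hκ
  have hx0 : 0 ≤ x := dotProduct_nonneg' hw (offspringVec_nonneg j u)
  have hxτ : x ≤ τ * offspringTotal ψ j u := by
    rw [hx, offspringTotal, Finset.mul_sum]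
    exact Finset.sum_le_sum fun i _ => mul_le_mul_of_nonneg_right (hwτ i) (offspringVec_nonneg j u i)
  have h5 : ∑ i, w i * (offspringVec ψ j u i - offspringVec ψ j u i * κ) = x * (1 - κ) := by
    rw [hx, dotProduct, Finset.sum_mul]
    exact Finset.sum_congr rfl fun i _ => by ring
  have h6 : Real.exp (-x) ≤ (1 + x)⁻¹ := by
    rw [Real.exp_neg]
    exact inv_anti₀ (by linarith) (by linarith [Real.add_one_le_exp x])
  have h7 := mul_le_mul_of_nonneg_left (div_one_add_mono hx0 hxτ) hx0
  have h8 : 1 - (1 + x)⁻¹ = x - x * (x / (1 + x)) := by field_simp; ring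
  simp only [h5]
  linarith

/-- The logarithmic moment condition controls the sum of the defects along a geometric sequence. -/
lemma sum_meanDefect_le (hψ : ∀ j, Measurable (ψ j))
    (hint : ∀ i j, Integrable fun u => offspringVec ψ j u i)
    (hlog : ∀ i j, Integrable fun u => offspringVec ψ j u i *
      Real.log (1 + offspringTotal ψ j u)) {ρ : ℝ} (hρ0 : 0 < ρ) (hρ1 : ρ < 1) (i j : Fin d)
    (n : ℕ) :
    ∑ l ∈ Finset.range n, meanDefect ψ (ρ ^ l) i j ≤
      (∫ u, offspringVec ψ j u i * Real.log (1 + offspringTotal ψ j u)) / (1 - ρ) := by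
  simp only [meanDefect]
  rw [← integral_finsetSum _ fun l _ => integrable_meanDefect hψ hint (by positivity) i j,
    ← integral_div]
  refine integral_mono (integrable_finsetSum _ fun l _ =>
    integrable_meanDefect hψ hint (by positivity) i j) ((hlog i j).div_const _) fun u => ?_
  simp only
  rw [← Finset.mul_sum, mul_div_assoc]
  exact mul_le_mul_of_nonneg_left
    (sum_geometric_div_one_add_le hρ0 hρ1 (offspringTotal_nonneg j u) n) (offspringVec_nonneg j u i)

lemma exists_defect_sequence (hψ : ∀ j, Measurable (ψ j))
    (hint : ∀ i j, Integrable fun u => offspringVec ψ j u i)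
    (hlog : ∀ i j, Integrable fun u => offspringVec ψ j u i *
      Real.log (1 + offspringTotal ψ j u)) {ρ : ℝ} (hρ0 : 0 < ρ) (hρ1 : ρ < 1) :
    ∃ δ : ℕ → ℝ, Summable δ ∧ (∀ l, 0 ≤ δ l) ∧
      ∀ l i j, meanDefect ψ (ρ ^ l) i j ≤ δ l * meanMatrix ψ i j := by
  have hr0 : ∀ l i j, 0 ≤ meanDefect ψ (ρ ^ l) i j := fun l => meanDefect_nonneg (by positivity)
  have hq0 : ∀ l i j, 0 ≤ meanDefect ψ (ρ ^ l) i j / meanMatrix ψ i j := fun l i j =>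
    div_nonneg (hr0 l i j) (meanMatrix_nonneg i j)
  refine ⟨fun l => ∑ i, ∑ j, meanDefect ψ (ρ ^ l) i j / meanMatrix ψ i j, ?_, fun l =>
    Finset.sum_nonneg fun i _ => Finset.sum_nonneg fun j _ => hq0 l i j, fun l i j => ?_⟩
  · refine summable_sum fun i _ => summable_sum fun j _ => Summable.div_const ?_ _
    exact summable_of_sum_range_le (fun l => hr0 l i j)
      (sum_meanDefect_le hψ hint hlog hρ0 hρ1 i j)
  -- Where the mean offspring number vanishes the quotient is 0 by convention, but the defect
  -- vanishes too, being at most the mean.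
  · rcases (meanMatrix_nonneg (ψ := ψ) i j).eq_or_lt with h | h
    · rw [← h, mul_zero, h]
      exact meanDefect_le_meanMatrix hψ hint (by positivity) i j
    · rw [← div_le_iff₀ h]
      exact (Finset.single_le_sum (f := fun j => meanDefect ψ (ρ ^ l) i j / meanMatrix ψ i j)
        (fun j _ => hq0 l i j) (Finset.mem_univ j)).trans
        (Finset.single_le_sum (f := fun i => ∑ j, meanDefect ψ (ρ ^ l) i j / meanMatrix ψ i j)
        (fun i _ => Finset.sum_nonneg fun j _ => hq0 l i j) (Finset.mem_univ i))

/-- Kolmogorov-type lower bound for the iterated log-Laplace transform, under the logarithmic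
moment condition. -/
theorem exists_half_vecMul_le_iterate_logLaplace (hd : 1 ≤ d) (hψ : ∀ j, Measurable (ψ j))
    (hint : ∀ i j, Integrable fun u => offspringVec ψ j u i)
    (hlog : ∀ i j, Integrable fun u => offspringVec ψ j u i *
      Real.log (1 + offspringTotal ψ j u)) {ρ C : ℝ} (hρ0 : 0 < ρ) (hρ1 : ρ < 1) (hC : 0 < C)
    (hup : ∀ n i j, (meanMatrix ψ ^ n) i j ≤ C * ρ ^ n) :
    ∃ t : ℝ, 0 < t ∧ ∀ w : Fin d → ℝ, 0 ≤ w → (∀ i, w i ≤ t) → ∀ l j,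
      1 / 2 * (w ᵥ* meanMatrix ψ ^ l) j ≤ (logLaplace ψ)^[l] w j := by
  obtain ⟨δ, hsum, hδ0, hδ⟩ := exists_defect_sequence hψ hint hlog hρ0 hρ1
  -- Arguments below $t=\rho^k/(dC)$ have $l$-th iterate at most $\rho^{l+k}$, so only the tail
  -- $\delta_k,\delta_{k+1},\dots$ of the relative errors is ever incurred. Its sum is made less
  -- than $1/2$.
  obtain ⟨k, hk⟩ : ∃ k, ∑' l, δ (l + k) < 1 / 2 :=
    ((tendsto_sum_nat_add δ).eventually_lt_const (by norm_num)).exists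
  have hpart : ∀ n, ∑ l ∈ Finset.range n, δ (l + k) ≤ 1 / 2 := fun n =>
    (((summable_nat_add_iff k).2 hsum).sum_le_tsum _ fun l _ => hδ0 _).trans hk.le
  have hdpos : (0 : ℝ) < d := by exact_mod_cast hd
  refine ⟨ρ ^ k / (d * C), by positivity, fun w hw hwt => ?_⟩
  set M := meanMatrix ψ with hM
  have hMn := fun n => matrix_pow_nonneg (A := M) meanMatrix_nonneg n
  have hu0 := iterate_logLaplace_nonneg hψ hw
  have hwM : ∀ l j, 0 ≤ (w ᵥ* M ^ l) j := fun l j =>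
    (hu0 l j).trans (iterate_logLaplace_le_vecMul hψ hint hw l j)
  have huρ : ∀ l i, (logLaplace ψ)^[l] w i ≤ ρ ^ (l + k) := by
    intro l i
    refine (iterate_logLaplace_le_vecMul hψ hint hw l i).trans ?_
    calc (w ᵥ* M ^ l) i = ∑ i', w i' * (M ^ l) i' i := rfl
      _ ≤ ∑ _i' : Fin d, ρ ^ k / (d * C) * (C * ρ ^ l) := Finset.sum_le_sum fun i' _ =>
          mul_le_mul (hwt i') (hup l i' i) (hMn l i' i) (by positivity)
      _ = ρ ^ (l + k) := by
          rw [Finset.sum_const, Finset.card_univ, Fintype.card_fin, nsmul_eq_mul, pow_add]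
          field_simp
  -- The losses accumulate as $\prod(1-\delta)$, which is at least $1-\sum\delta$.
  have key : ∀ l j, (1 - ∑ i ∈ Finset.range l, δ (i + k)) * (w ᵥ* M ^ l) j ≤
      (logLaplace ψ)^[l] w j := by
    intro l
    induction l with
    | zero => intro j; simp
    | succ l ih =>
      intro j
      set s := ∑ i ∈ Finset.range l, δ (i + k) with hs
      have hs0 : 0 ≤ s := Finset.sum_nonneg fun i _ => hδ0 _
      have hδl : δ (l + k) ≤ 1 / 2 := by
        have := hpart (l + 1)
        rw [Finset.sum_range_succ] at this
        linarith
      rw [Function.iterate_succ_apply', Finset.sum_range_succ, ← hs]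
      refine le_trans ?_ (one_sub_mul_vecMul_le_logLaplace hψ hint (hu0 l)
        (pow_nonneg hρ0.le (l + k)) (huρ l) (hδ (l + k)) j)
      have h1 : (1 - s) * (w ᵥ* M ^ (l + 1)) j ≤ ((logLaplace ψ)^[l] w ᵥ* M) j := by
        have h2 := vecMul_mono (B := M) meanMatrix_nonneg (v := (1 - s) • (w ᵥ* M ^ l)) ih j
        rwa [Matrix.smul_vecMul, Matrix.vecMul_vecMul, ← pow_succ] at h2
      have h3 := mul_le_mul_of_nonneg_left h1 (show 0 ≤ 1 - δ (l + k) by linarith)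
      nlinarith [mul_nonneg (mul_nonneg hs0 (hδ0 (l + k))) (hwM (l + 1) j)]
  intro l j
  refine le_trans ?_ (key l j)
  exact mul_le_mul_of_nonneg_right (by linarith [hpart l]) (hwM l j)

end LogLaplace

/-! ### Consequences of the $\xi\ln\xi$ moment condition -/

section Moments

variable {d : ℕ} {ψ : Reproduction d}

lemma natCast_le_three_add_mul_log (n : ℕ) : (n : ℝ) ≤ 3 + n * Real.log n := by
  rcases lt_or_ge n 3 with h | h
  · have h0 : 0 ≤ (n : ℝ) * Real.log n := mul_nonneg (Nat.cast_nonneg _) (Real.log_natCast_nonneg n)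
    have : (n : ℝ) < 3 := by exact_mod_cast h
    linarith
  · have h1 : (3 : ℝ) ≤ n := by exact_mod_cast h
    have h2 : 1 ≤ Real.log n := by
      rw [Real.le_log_iff_exp_le (by linarith)]
      linarith [Real.exp_one_lt_d9]
    nlinarith

lemma integrable_offspringVec (hψ : ∀ j, Measurable (ψ j)) (hlog : ∀ i j, Integrable fun u =>
    offspringVec ψ j u i * Real.log (offspringVec ψ j u i)) (i j : Fin d) :
    Integrable fun u => offspringVec ψ j u i := by
  refine ((integrable_const (3 : ℝ)).add (hlog i j)).mono'
    (measurable_offspringVec hψ i j).aestronglyMeasurable (ae_of_all _ fun u => ?_)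
  rw [Real.norm_of_nonneg (offspringVec_nonneg j u i)]
  exact natCast_le_three_add_mul_log _

lemma mul_log_le_mul_log_add {a b : ℝ} (ha : 0 ≤ a) (hb : 0 < b) :
    a * Real.log b ≤ a * Real.log a + b := by
  rcases ha.eq_or_lt with rfl | ha
  · simpa using hb.le
  · have h1 := Real.log_le_sub_one_of_pos (div_pos hb ha)
    rw [Real.log_div hb.ne' ha.ne'] at h1
    have h2 := mul_le_mul_of_nonneg_left h1 ha.le
    have h3 : a * (b / a - 1) = b - a := by field_simp
    rw [h3] at h2
    linarith

/-- The inequality $a\log b\le a\log a+b$ avoids mixed moments: the logarithm of the total number of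
children is traded for that of the single coordinate plus an integrable term. -/
lemma integrable_mul_log_offspringTotal (hψ : ∀ j, Measurable (ψ j))
    (hlog : ∀ i j, Integrable fun u =>
      offspringVec ψ j u i * Real.log (offspringVec ψ j u i)) (i j : Fin d) :
    Integrable fun u => offspringVec ψ j u i * Real.log (1 + offspringTotal ψ j u) := by
  have hm := measurable_offspringTotal hψ j
  have hs : Integrable (offspringTotal ψ j) :=
    integrable_finsetSum _ fun i _ => integrable_offspringVec hψ hlog i j
  refine ((hlog i j).add ((integrable_const (1 : ℝ)).add hs)).mono'
    ((measurable_offspringVec hψ i j).mul (hm.const_add 1).log).aestronglyMeasurable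
    (ae_of_all _ fun u => ?_)
  have h0 : 0 ≤ offspringTotal ψ j u := offspringTotal_nonneg j u
  rw [Real.norm_of_nonneg (mul_nonneg (offspringVec_nonneg j u i) (Real.log_nonneg (by linarith)))]
  exact mul_log_le_mul_log_add (offspringVec_nonneg j u i) (by linarith)

end Moments

/-! ### Laplace transform of the branching process -/

section RandomProducts

variable {Ω : Type*} [MeasurableSpace Ω] {P : Measure Ω}

lemma measurable_sum_range_random {N : Ω → ℕ} (hN : Measurable N) {f : ℕ → Ω → ℕ}
    (hf : ∀ k, Measurable (f k)) : Measurable fun ω => ∑ k ∈ Finset.range (N ω), f k ω := by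
  have h : Measurable fun p : ℕ × Ω => ∑ k ∈ Finset.range p.1, f k p.2 :=
    measurable_from_prod_countable_right fun n =>
      Finset.measurable_sum (Finset.range n) fun k _ => hf k
  exact h.comp (hN.prodMk measurable_id)

/-- Wald-type identity for products of a random number of independent factors. -/
lemma lintegral_prod_prod_range_random [IsProbabilityMeasure P] {ι I : Type*} [Fintype ι]
    [MeasurableSpace I] {μ : Measure I} {N : Ω → ι → ℕ} (hN : Measurable N)
    {G : (Σ _ : ι, ℕ) → Ω → I} (hG : ∀ q, Measurable (G q)) (hGμ : ∀ q, P.map (G q) = μ)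
    (hGind : iIndepFun G P) (hNG : IndepFun N (fun ω q => G q ω) P)
    {g : ι → I → ℝ≥0∞} (hg : ∀ i, Measurable (g i)) :
    ∫⁻ ω, ∏ i, ∏ k ∈ Finset.range (N ω i), g i (G ⟨i, k⟩ ω) ∂P =
      ∫⁻ ω, ∏ i, (∫⁻ x, g i x ∂μ) ^ N ω i ∂P := by
  have hGm : Measurable fun ω q => G q ω := measurable_pi_lambda _ hG
  set H : (ι → ℕ) × ((Σ _ : ι, ℕ) → I) → ℝ≥0∞ := fun p =>
    ∏ i, ∏ k ∈ Finset.range (p.1 i), g i (p.2 ⟨i, k⟩) with hH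
  have hHm : Measurable H := measurable_from_prod_countable_right fun ν =>
    Finset.measurable_prod Finset.univ fun i _ => Finset.measurable_prod (Finset.range (ν i))
      fun k _ => (hg i).comp (measurable_pi_apply (⟨i, k⟩ : Σ _ : ι, ℕ))
  have hmap := (indepFun_iff_map_prod_eq_prod_map_map hN.aemeasurable hGm.aemeasurable).1 hNG
  have hinner : ∀ ν : ι → ℕ, ∫⁻ x, H (ν, x) ∂(P.map fun ω q => G q ω) =
      ∏ i, (∫⁻ x, g i x ∂μ) ^ ν i := by
    intro ν
    rw [lintegral_map (f := fun x => H (ν, x)) (hHm.comp measurable_prodMk_left) hGm]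
    simp only [hH, Finset.prod_sigma']
    rw [lintegral_prod_eq_prod_lintegral_of_indepFun _
      (fun (q : Σ _ : ι, ℕ) ω => g q.1 (G q ω))
      (hGind.comp (fun q => g q.1) fun q => hg q.1) fun q => (hg q.1).comp (hG q)]
    rw [Finset.prod_sigma]
    refine Finset.prod_congr rfl fun i _ => ?_
    rw [Finset.prod_congr rfl fun k _ => by
      rw [← lintegral_map (hg i) (hG ⟨i, k⟩), hGμ], Finset.prod_const, Finset.card_range]
  calc _ = ∫⁻ ω, H (N ω, fun q => G q ω) ∂P := rfl
    _ = ∫⁻ p, H p ∂(P.map fun ω => (N ω, fun q => G q ω)) :=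
        (lintegral_map hHm (hN.prodMk hGm)).symm
    _ = ∫⁻ ν, ∏ i, (∫⁻ x, g i x ∂μ) ^ ν i ∂(P.map N) := by
        have := Measure.isProbabilityMeasure_map (μ := P) hGm.aemeasurable
        rw [hmap, lintegral_prod _ hHm.aemeasurable]
        exact lintegral_congr hinner
    _ = _ := lintegral_map (measurable_of_countable _) hN

/-- Formulated with generated σ-algebras, so that a measurability lemma for the population can be
applied directly in the σ-algebra of the past. -/
lemma iIndepFun.indepFun_of_measurable_iSup {κ I E F : Type*} [MeasurableSpace I]
    [MeasurableSpace E] [MeasurableSpace F] {U : κ → Ω → I} (hU : ∀ q, Measurable (U q))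
    (hind : iIndepFun U P) {S T : Set κ} (hST : Disjoint S T) {f : Ω → E} {g : Ω → F}
    (hf : Measurable[⨆ q ∈ S, MeasurableSpace.comap (U q) inferInstance] f)
    (hg : Measurable[⨆ q ∈ T, MeasurableSpace.comap (U q) inferInstance] g) : IndepFun f g P := by
  have h1 := indep_iSup_of_disjoint (fun q => (hU q).comap_le) hind hST
  exact indep_of_indep_of_le_left (indep_of_indep_of_le_right h1 hg.comap_le) hf.comap_le

/-- Integrating out independent variables one after the other. -/
lemma lintegral_eq_lintegral_lintegral_of_indepFun [IsProbabilityMeasure P] {E F : Type*}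
    [MeasurableSpace E] [MeasurableSpace F] {f : Ω → E} {g : Ω → F} (hf : Measurable f)
    (hg : Measurable g) (hfg : IndepFun f g P) {H : E × F → ℝ≥0∞} (hH : Measurable H) :
    ∫⁻ ω, H (f ω, g ω) ∂P = ∫⁻ ω', ∫⁻ ω, H (f ω, g ω') ∂P ∂P := by
  have hmap := (indepFun_iff_map_prod_eq_prod_map_map hf.aemeasurable hg.aemeasurable).1 hfg
  have := Measure.isProbabilityMeasure_map (μ := P) hf.aemeasurable
  have := Measure.isProbabilityMeasure_map (μ := P) hg.aemeasurable
  rw [← lintegral_map (f := H) (g := fun ω => (f ω, g ω)) hH (hf.prodMk hg), hmap,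
    lintegral_prod_symm' _ hH, lintegral_map hH.lintegral_prod_left' hg]
  exact lintegral_congr fun ω' => lintegral_map (hH.comp measurable_prodMk_right) hf

end RandomProducts

/-! ### The branching recursion for deterministic immigration -/

section Progeny

variable {d : ℕ}

/-- The numbers of individuals of each type in generation `l` of the branching process with
reproduction law `ψ`, driven by `u` and started from `v`. -/
def progeny (ψ : Reproduction d) (v : Fin d → ℕ) (u : ℕ → ℕ → Fin d → unitInterval) :
    ℕ → Fin d → ℕ
  | 0 => v
  | l + 1 => fun i => ∑ j, ∑ k ∈ Finset.range (progeny ψ v u l j), ψ j (u l k j) i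

variable {ψ : Reproduction d}

/-- Asking only for measurability of the variables of age below `L` allows the use of the σ-algebra
of those variables alone, which yields independence from the next generation. -/
lemma measurable_progeny {Ω : Type*} [MeasurableSpace Ω] (hψ : ∀ j, Measurable (ψ j))
    {v : Ω → Fin d → ℕ} (hv : Measurable v) {u : ℕ → ℕ → Fin d → Ω → unitInterval} {L : ℕ}
    (hu : ∀ l < L, ∀ k j, Measurable (u l k j)) :
    Measurable fun ω => progeny ψ (v ω) (fun l k j => u l k j ω) L := by
  induction L with
  | zero => exact hv
  | succ L ih =>
    have ih' := ih fun l hl => hu l (by omega)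
    refine measurable_pi_lambda _ fun i => Finset.measurable_sum _ fun j _ => ?_
    exact measurable_sum_range_random ((measurable_pi_apply j).comp ih') fun k =>
      (measurable_pi_apply i).comp ((hψ j).comp (hu L (by omega) k j))

lemma dotProduct_progeny_succ (w : Fin d → ℝ) (v : Fin d → ℕ)
    (u : ℕ → ℕ → Fin d → unitInterval) (l : ℕ) :
    w ⬝ᵥ (fun i => (progeny ψ v u (l + 1) i : ℝ)) =
      ∑ j, ∑ k ∈ Finset.range (progeny ψ v u l j), w ⬝ᵥ offspringVec ψ j (u l k j) := by
  simp only [dotProduct, progeny, offspringVec, Nat.cast_sum, Finset.mul_sum]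
  rw [Finset.sum_comm]
  exact Finset.sum_congr rfl fun j _ => Finset.sum_comm

variable {Ω : Type*} [MeasurableSpace Ω] {P : Measure Ω} [IsProbabilityMeasure P]
  {U : ℕ → ℕ → ℕ → Fin d → Ω → unitInterval}

/-- The branching property, applied to the last reproduction step of all immigrant families at once:
given the population, each individual of type $j$ contributes an independent factor with mean
$e^{-\Phi(w)_j}$. -/
lemma lintegral_exp_neg_sum_progeny_succ (hψ : ∀ j, Measurable (ψ j))
    (hU : ∀ m l k j, Measurable (U m l k j)) (hUμ : ∀ m l k j, P.map (U m l k j) = volume)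
    (hind : iIndepFun (fun (q : ℕ × ℕ × ℕ × Fin d) => U q.1 q.2.1 q.2.2.1 q.2.2.2) P)
    (v : ℕ → Fin d → ℕ) {w : Fin d → ℝ} (hw : 0 ≤ w) (n : ℕ) :
    ∫⁻ ω, ENNReal.ofReal (Real.exp (-∑ m ∈ Finset.range (n + 1),
      w ⬝ᵥ fun i => (progeny ψ (v m) (fun l k j => U m l k j ω) (n - m + 1) i : ℝ))) ∂P =
    ∫⁻ ω, ENNReal.ofReal (Real.exp (-∑ m ∈ Finset.range (n + 1),
      logLaplace ψ w ⬝ᵥ fun i => (progeny ψ (v m) (fun l k j => U m l k j ω) (n - m) i : ℝ))) ∂P := by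
  set N : Ω → Fin (n + 1) × Fin d → ℕ := fun ω p =>
    progeny ψ (v p.1) (fun l k j => U p.1 l k j ω) (n - p.1) p.2 with hN
  -- The step from time $n$ to $n+1$ uses, for the family immigrated at time $m$, the uniforms of
  -- age $n-m$. The population before the step depends only on indices with $m+l<n$.
  set e : (Σ _ : Fin (n + 1) × Fin d, ℕ) → ℕ × ℕ × ℕ × Fin d := fun q =>
    (q.1.1, n - q.1.1, q.2, q.1.2) with he
  have he_inj : Function.Injective e := by
    rintro ⟨⟨m, j⟩, k⟩ ⟨⟨m', j'⟩, k'⟩ h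
    simp only [he, Prod.mk.injEq] at h
    obtain ⟨h1, -, rfl, rfl⟩ := h
    rw [Fin.ext h1]
  set G : (Σ _ : Fin (n + 1) × Fin d, ℕ) → Ω → unitInterval := fun q =>
    U (e q).1 (e q).2.1 (e q).2.2.1 (e q).2.2.2 with hGdef
  have hNm : Measurable N := measurable_pi_lambda _ fun p =>
    (measurable_pi_apply p.2).comp (measurable_progeny hψ measurable_const fun l _ => hU p.1 l)
  have hNG : IndepFun N (fun ω q => G q ω) P := by
    refine iIndepFun.indepFun_of_measurable_iSup (S := {q | q.1 + q.2.1 < n})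
      (T := {q | q.1 + q.2.1 = n}) (fun q => hU _ _ _ _) hind ?_ ?_ ?_
    · exact Set.disjoint_left.2 fun q (h1 : _ < n) (h2 : _ = n) => h1.ne h2
    · refine @measurable_pi_lambda _ _ _ (_) _ _ fun p => (measurable_pi_apply p.2).comp ?_
      refine @measurable_progeny _ _ _ (_) hψ _ (@measurable_const _ _ _ (_) _) _ _
        fun l hl k j => ?_
      refine Measurable.mono (comap_measurable _) ?_ le_rfl
      exact le_iSup₂_of_le ((p.1 : ℕ), l, k, j) (show (p.1 : ℕ) + l < n by omega) le_rfl
    · refine @measurable_pi_lambda _ _ _ (_) _ _ fun q => ?_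
      refine Measurable.mono (comap_measurable _) ?_ le_rfl
      exact le_iSup₂_of_le (e q) (show (q.1.1 : ℕ) + (n - q.1.1) = n by have := q.1.1.2; omega)
        le_rfl
  have hg : ∀ p : Fin (n + 1) × Fin d, Measurable fun u =>
      ENNReal.ofReal (Real.exp (-(w ⬝ᵥ offspringVec ψ p.2 u))) := fun p =>
    (measurable_dotProduct_offspringVec hψ w p.2).neg.exp.ennreal_ofReal
  have key := lintegral_prod_prod_range_random (μ := volume) hNm (fun q => hU _ _ _ _)
    (fun q => hUμ _ _ _ _) (hind.precomp he_inj) hNG hg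
  have hlap : ∀ j, ∫⁻ u, ENNReal.ofReal (Real.exp (-(w ⬝ᵥ offspringVec ψ j u))) =
      ENNReal.ofReal (Real.exp (-logLaplace ψ w j)) := fun j => by
    rw [exp_neg_logLaplace hψ hw, ofReal_integral_eq_lintegral_ofReal
      (integrable_exp_neg_dotProduct hψ hw j) (ae_of_all _ fun u => (Real.exp_pos _).le)]
  simp only [hlap] at key
  refine Eq.trans (lintegral_congr fun ω => ?_) (key.trans (lintegral_congr fun ω => ?_))
  · rw [Fintype.prod_prod_type, ← Fin.sum_univ_eq_sum_range (fun m => w ⬝ᵥ fun i =>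
      (progeny ψ (v m) (fun l k j => U m l k j ω) (n - m + 1) i : ℝ)), ← Finset.sum_neg_distrib,
      Real.exp_sum, ENNReal.ofReal_prod_of_nonneg fun _ _ => (Real.exp_pos _).le]
    refine Finset.prod_congr rfl fun m _ => ?_
    rw [dotProduct_progeny_succ, ← Finset.sum_neg_distrib,
      Real.exp_sum, ENNReal.ofReal_prod_of_nonneg fun _ _ => (Real.exp_pos _).le]
    refine Finset.prod_congr rfl fun j _ => ?_
    rw [← Finset.sum_neg_distrib,
      Real.exp_sum, ENNReal.ofReal_prod_of_nonneg fun _ _ => (Real.exp_pos _).le]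
  · rw [Fintype.prod_prod_type, ← Fin.sum_univ_eq_sum_range (fun m => logLaplace ψ w ⬝ᵥ fun i =>
      (progeny ψ (v m) (fun l k j => U m l k j ω) (n - m) i : ℝ)), ← Finset.sum_neg_distrib,
      Real.exp_sum, ENNReal.ofReal_prod_of_nonneg fun _ _ => (Real.exp_pos _).le]
    refine Finset.prod_congr rfl fun m _ => ?_
    rw [dotProduct, ← Finset.sum_neg_distrib,
      Real.exp_sum, ENNReal.ofReal_prod_of_nonneg fun _ _ => (Real.exp_pos _).le]
    refine Finset.prod_congr rfl fun j _ => ?_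
    rw [← ENNReal.ofReal_pow (Real.exp_pos _).le, ← Real.exp_nat_mul]
    congr 2
    simp only [hN]
    ring

/-- The Laplace transform of the branching process with deterministic immigration. -/
theorem lintegral_exp_neg_sum_progeny (hψ : ∀ j, Measurable (ψ j))
    (hU : ∀ m l k j, Measurable (U m l k j)) (hUμ : ∀ m l k j, P.map (U m l k j) = volume)
    (hind : iIndepFun (fun (q : ℕ × ℕ × ℕ × Fin d) => U q.1 q.2.1 q.2.2.1 q.2.2.2) P)
    (v : ℕ → Fin d → ℕ) {w : Fin d → ℝ} (hw : 0 ≤ w) (n : ℕ) :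
    ∫⁻ ω, ENNReal.ofReal (Real.exp (-∑ m ∈ Finset.range (n + 1),
      w ⬝ᵥ fun i => (progeny ψ (v m) (fun l k j => U m l k j ω) (n - m) i : ℝ))) ∂P =
    ENNReal.ofReal (Real.exp (-∑ m ∈ Finset.range (n + 1),
      (logLaplace ψ)^[n - m] w ⬝ᵥ fun i => (v m i : ℝ))) := by
  induction n generalizing w with
  | zero => simp [progeny]
  | succ n ih =>
    -- The newest immigrants have not reproduced yet and contribute a deterministic factor.
    have h1 : ∀ ω, ∑ m ∈ Finset.range (n + 1 + 1), w ⬝ᵥ (fun i =>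
        (progeny ψ (v m) (fun l k j => U m l k j ω) (n + 1 - m) i : ℝ)) =
        ∑ m ∈ Finset.range (n + 1), w ⬝ᵥ (fun i =>
        (progeny ψ (v m) (fun l k j => U m l k j ω) (n - m + 1) i : ℝ)) +
        w ⬝ᵥ fun i => (v (n + 1) i : ℝ) := by
      intro ω
      rw [Finset.sum_range_succ, Nat.sub_self]
      congr 1
      refine Finset.sum_congr rfl fun m hm => ?_
      rw [Nat.succ_sub (Finset.mem_range_succ_iff.1 hm)]
    have h2 : ∑ m ∈ Finset.range (n + 1 + 1), (logLaplace ψ)^[n + 1 - m] w ⬝ᵥ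
        (fun i => (v m i : ℝ)) = ∑ m ∈ Finset.range (n + 1),
          (logLaplace ψ)^[n - m] (logLaplace ψ w) ⬝ᵥ (fun i => (v m i : ℝ)) +
        w ⬝ᵥ fun i => (v (n + 1) i : ℝ) := by
      rw [Finset.sum_range_succ, Nat.sub_self]
      congr 1
      refine Finset.sum_congr rfl fun m hm => ?_
      rw [Nat.succ_sub (Finset.mem_range_succ_iff.1 hm), Function.iterate_succ_apply]
    simp only [h1, h2, neg_add, Real.exp_add, ENNReal.ofReal_mul (Real.exp_pos _).le]
    rw [lintegral_mul_const' _ _ ENNReal.ofReal_ne_top,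
      lintegral_exp_neg_sum_progeny_succ hψ hU hUμ hind v hw n, ih (logLaplace_nonneg hψ hw)]

end Progeny

/-! ### Recurrence of the branching process with immigration -/

section ExponentialMarkov

variable {Ω : Type*} [MeasurableSpace Ω] {P : Measure Ω}

lemma measure_le_exp_mul_lintegral {f : Ω → ℝ} (hf : Measurable f) (a : ℝ) :
    P {ω | f ω ≤ a} ≤
      ENNReal.ofReal (Real.exp a) * ∫⁻ ω, ENNReal.ofReal (Real.exp (-f ω)) ∂P := by
  rw [← lintegral_indicator_one (measurableSet_le_const hf a),
    ← lintegral_const_mul' _ _ ENNReal.ofReal_ne_top]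
  refine lintegral_mono fun ω => Set.indicator_apply_le' (fun (hω : f ω ≤ a) => ?_) fun _ => zero_le
  rw [← ENNReal.ofReal_mul (Real.exp_pos _).le, ← Real.exp_add]
  simpa using hω

/-- On the event $f>2x$ the integrand is at most $e^{-2x}$, and elsewhere it is at most 1. For $x>0$
a bound on the Laplace transform thus becomes a positive lower bound on a probability. -/
lemma exp_sub_exp_le_measure [IsProbabilityMeasure P] {f : Ω → ℝ} (hf : Measurable f)
    (hf0 : ∀ ω, 0 ≤ f ω) {x : ℝ}
    (h : ENNReal.ofReal (Real.exp (-x)) ≤ ∫⁻ ω, ENNReal.ofReal (Real.exp (-f ω)) ∂P) :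
    ENNReal.ofReal (Real.exp (-x) - Real.exp (-(2 * x))) ≤ P {ω | f ω ≤ 2 * x} := by
  rw [ENNReal.ofReal_sub _ (Real.exp_pos _).le, tsub_le_iff_right]
  refine h.trans ?_
  rw [← lintegral_indicator_one (measurableSet_le_const hf _)]
  have hconst : ENNReal.ofReal (Real.exp (-(2 * x))) =
      ∫⁻ _ω, ENNReal.ofReal (Real.exp (-(2 * x))) ∂P := by simp
  rw [hconst, ← lintegral_add_right _ measurable_const]
  refine lintegral_mono fun ω => ?_
  by_cases hω : f ω ≤ 2 * x
  · rw [Set.indicator_of_mem (show ω ∈ {ω | f ω ≤ 2 * x} from hω)]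
    refine le_add_of_le_left ?_
    simpa using hf0 ω
  · refine le_add_of_le_right (ENNReal.ofReal_le_ofReal (Real.exp_le_exp.2 ?_))
    linarith

end ExponentialMarkov

/-! ### The population as a function of separate reproduction and immigration data -/

section TotalPopulation

variable {d : ℕ}

/-- The population at time `n` of the branching process with immigration, as a function of the
driving variables and of the immigration. -/
noncomputable def totalPopulation (ψ : Reproduction d) (n : ℕ) (u : ℕ × ℕ × ℕ × Fin d → unitInterval)
    (v : ℕ → Fin d → ℝ) : Fin d → ℝ := fun i =>
  ∑ m ∈ Finset.range (n + 1),
    (progeny ψ (fun i => ⌊v m i⌋₊) (fun l k j => u (m, l, k, j)) (n - m) i : ℝ)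

variable {ψ : Reproduction d}

lemma totalPopulation_nonneg (n : ℕ) (u : ℕ × ℕ × ℕ × Fin d → unitInterval) (v : ℕ → Fin d → ℝ) :
    0 ≤ totalPopulation ψ n u v := fun _ => Finset.sum_nonneg fun _ _ => Nat.cast_nonneg _

lemma measurable_totalPopulation {Ω : Type*} [MeasurableSpace Ω] (hψ : ∀ j, Measurable (ψ j))
    (n : ℕ) {u : Ω → ℕ × ℕ × ℕ × Fin d → unitInterval} (hu : Measurable u)
    {v : Ω → ℕ → Fin d → ℝ} (hv : Measurable v) :
    Measurable fun ω => totalPopulation ψ n (u ω) (v ω) := by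
  refine measurable_pi_lambda _ fun i => Finset.measurable_sum _ fun m _ => ?_
  refine measurable_from_top.comp ((measurable_pi_apply i).comp (measurable_progeny hψ ?_ ?_))
  · exact measurable_pi_lambda _ fun i => Nat.measurable_floor.comp
      ((measurable_pi_apply i).comp ((measurable_pi_apply m).comp hv))
  · exact fun l _ k j => (measurable_pi_apply _).comp hu

lemma branchingProcess_eq_totalPopulation {Ω : Type*} {Ψ : ℕ → Ω → Reproduction d}
    {U : ℕ → ℕ → ℕ → Fin d → Ω → unitInterval} {Y : ℕ → Ω → Fin d → ℝ} {ω : Ω}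
    (hΨ : ∀ n, 1 ≤ n → Ψ n ω = ψ) (n : ℕ) :
    branchingProcess Ψ U Y n ω =
      totalPopulation ψ n (fun q => U q.1 q.2.1 q.2.2.1 q.2.2.2 ω) (fun m => Y m ω) := by
  have h : ∀ m l, descendants Ψ U Y m l ω =
      progeny ψ (fun i => ⌊Y m ω i⌋₊) (fun l k j => U m l k j ω) l := by
    intro m l
    induction l with
    | zero => rfl
    | succ l ih =>
      funext i
      simp only [descendants, progeny, ih, offspring, hΨ _ (Nat.le_add_left 1 (m + l))]
  funext i
  simp only [branchingProcess, totalPopulation, h, Nat.cast_sum]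

lemma le_dotProduct_floor (hd : 1 ≤ d) {x v : Fin d → ℝ} {a : ℝ} (ha : 0 ≤ a) (hx : ∀ j, a ≤ x j)
    (hv : 0 ≤ v) : a * max (‖v‖ - 1) 0 ≤ x ⬝ᵥ fun i => (⌊v i⌋₊ : ℝ) := by
  obtain ⟨j, hj⟩ := exists_apply_eq_norm hd hv
  have h1 : max (‖v‖ - 1) 0 ≤ ⌊v j⌋₊ := by
    rw [← hj]
    exact max_le (Nat.sub_one_lt_floor _).le (Nat.cast_nonneg _)
  calc _ ≤ x j * (⌊v j⌋₊ : ℝ) := mul_le_mul (hx j) h1 (le_max_right _ _) (ha.trans (hx j))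
    _ ≤ _ := Finset.single_le_sum (f := fun j => x j * (⌊v j⌋₊ : ℝ))
      (fun k _ => mul_nonneg (ha.trans (hx k)) (Nat.cast_nonneg _)) (Finset.mem_univ j)

lemma one_dotProduct_le {v : Fin d → ℝ} : (1 : Fin d → ℝ) ⬝ᵥ v ≤ d * ‖v‖ := by
  rw [one_dotProduct]
  calc ∑ i, v i ≤ ∑ _i : Fin d, ‖v‖ := Finset.sum_le_sum fun i _ => le_norm_apply i
    _ = _ := by simp

lemma norm_le_one_dotProduct {v : Fin d → ℝ} (hv : 0 ≤ v) : ‖v‖ ≤ (1 : Fin d → ℝ) ⬝ᵥ v := by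
  rw [one_dotProduct]
  refine (pi_norm_le_iff_of_nonneg (Finset.sum_nonneg fun i _ => hv i)).2 fun i => ?_
  rw [Real.norm_of_nonneg (hv i)]
  exact Finset.single_le_sum (f := v) (fun i _ => hv i) (Finset.mem_univ i)

/-- Lower bound for the iterated log-Laplace transform of order `ρ ^ m`. -/
lemma exists_mul_pow_le_iterate_logLaplace (hd : 1 ≤ d) (hψ : ∀ j, Measurable (ψ j))
    (hlog : ∀ i j, Integrable fun u => offspringVec ψ j u i * Real.log (offspringVec ψ j u i))
    (hM : (meanMatrix ψ).IsPrimitive) (hρ : specRadius (meanMatrix ψ) < 1) :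
    ∃ t : ℝ, 0 < t ∧ ∃ c : ℝ, 0 < c ∧ ∃ K : ℕ, ∀ w : Fin d → ℝ, 0 ≤ w → (∀ i, w i ≤ t) →
      (∃ i, w i = t) → ∀ m, K ≤ m → ∀ j,
        c * specRadius (meanMatrix ψ) ^ m ≤ (logLaplace ψ)^[m] w j := by
  obtain ⟨hρ0, K, hK, c, hc, C, hC, hup, hlo⟩ := exists_pow_bounds hd hM
  obtain ⟨t, ht, h⟩ := exists_half_vecMul_le_iterate_logLaplace hd hψ
    (integrable_offspringVec hψ hlog) (integrable_mul_log_offspringTotal hψ hlog) hρ0 hρ hC hup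
  -- One coordinate equal to $t$ is enough, which covers both constant vectors and multiples of unit
  -- vectors.
  refine ⟨t, ht, 1 / 2 * (t * c), by positivity, K, fun w hw hwt ⟨i, hi⟩ m hm j => ?_⟩
  refine le_trans ?_ (h w hw hwt m j)
  rw [mul_assoc, mul_assoc]
  refine mul_le_mul_of_nonneg_left ?_ (by norm_num)
  calc t * (c * specRadius (meanMatrix ψ) ^ m) ≤ w i * (meanMatrix ψ ^ m) i j := by
        rw [hi]; exact mul_le_mul_of_nonneg_left (hlo m hm i j) ht.le
    _ ≤ _ := Finset.single_le_sum (f := fun i => w i * (meanMatrix ψ ^ m) i j)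
      (fun k _ => mul_nonneg (hw k) (matrix_pow_nonneg meanMatrix_nonneg m k j))
      (Finset.mem_univ i)

end TotalPopulation

/-! ### Estimates for fixed immigration -/

section Quenched

variable {d : ℕ} {ψ : Reproduction d} {Ω : Type*} [MeasurableSpace Ω] {P : Measure Ω}
  [IsProbabilityMeasure P] {U : ℕ × ℕ × ℕ × Fin d → Ω → unitInterval}

lemma lintegral_exp_neg_dotProduct_totalPopulation (hψ : ∀ j, Measurable (ψ j))
    (hU : ∀ q, Measurable (U q)) (hUμ : ∀ q, P.map (U q) = volume) (hind : iIndepFun U P)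
    (v : ℕ → Fin d → ℝ) {w : Fin d → ℝ} (hw : 0 ≤ w) (n : ℕ) :
    ∫⁻ ω, ENNReal.ofReal (Real.exp (-(w ⬝ᵥ totalPopulation ψ n (fun q => U q ω) v))) ∂P =
    ENNReal.ofReal (Real.exp (-∑ m ∈ Finset.range (n + 1),
      (logLaplace ψ)^[m] w ⬝ᵥ fun i => (⌊v (n - m) i⌋₊ : ℝ))) := by
  have h1 : ∑ m ∈ Finset.range (n + 1), (logLaplace ψ)^[m] w ⬝ᵥ
      (fun i => (⌊v (n - m) i⌋₊ : ℝ)) = ∑ m ∈ Finset.range (n + 1),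
      (logLaplace ψ)^[n - m] w ⬝ᵥ (fun i => (⌊v m i⌋₊ : ℝ)) := by
    rw [← Finset.sum_flip]
    refine Finset.sum_congr rfl fun m hm => ?_
    rw [Nat.sub_sub_self (Finset.mem_range_succ_iff.1 hm)]
  rw [h1, ← lintegral_exp_neg_sum_progeny (U := fun m l k j => U (m, l, k, j)) hψ
    (fun _ _ _ _ => hU _) (fun _ _ _ _ => hUμ _) hind (fun m i => ⌊v m i⌋₊) hw n]
  refine lintegral_congr fun ω => ?_
  congr 3
  simp only [dotProduct, totalPopulation, Finset.mul_sum]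
  exact Finset.sum_comm

lemma measurable_dotProduct_totalPopulation (hψ : ∀ j, Measurable (ψ j))
    (hU : ∀ q, Measurable (U q)) (v : ℕ → Fin d → ℝ) (w : Fin d → ℝ) (n : ℕ) :
    Measurable fun ω => w ⬝ᵥ totalPopulation ψ n (fun q => U q ω) v :=
  Finset.measurable_sum _ fun i _ => ((measurable_pi_apply i).comp
    (measurable_totalPopulation hψ n (measurable_pi_lambda _ hU) measurable_const)).const_mul _

/-- Given the immigration, the branching process is tight if the autoregressive process is
bounded. -/
lemma exp_sub_exp_le_measure_totalPopulation (hψ : ∀ j, Measurable (ψ j))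
    (hint : ∀ i j, Integrable fun u => offspringVec ψ j u i)
    (hU : ∀ q, Measurable (U q)) (hUμ : ∀ q, P.map (U q) = volume) (hind : iIndepFun U P)
    {v : ℕ → Fin d → ℝ} (hv : ∀ m, 0 ≤ v m) {n : ℕ} {b : ℝ}
    (hb : ‖∑ m ∈ Finset.range (n + 1), meanMatrix ψ ^ m *ᵥ v (n - m)‖ ≤ b) :
    ENNReal.ofReal (Real.exp (-(d * b)) - Real.exp (-(2 * (d * b)))) ≤
      P {ω | ‖totalPopulation ψ n (fun q => U q ω) v‖ ≤ 2 * (d * b)} := by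
  have h1 := exp_sub_exp_le_measure (P := P) (x := d * b)
    (measurable_dotProduct_totalPopulation hψ hU v 1 n)
    (fun ω => dotProduct_nonneg' zero_le_one (totalPopulation_nonneg n _ v)) ?_
  · refine h1.trans (measure_mono fun ω hω => ?_)
    replace hω : 1 ⬝ᵥ totalPopulation ψ n (fun q => U q ω) v ≤ 2 * (d * b) := hω
    exact (norm_le_one_dotProduct (totalPopulation_nonneg n _ v)).trans hω
  · rw [lintegral_exp_neg_dotProduct_totalPopulation hψ hU hUμ hind v zero_le_one n]
    refine ENNReal.ofReal_le_ofReal (Real.exp_le_exp.2 (neg_le_neg ?_))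
    -- Linearising the iterates and dropping the floors turns the exponent into the coordinate sum
    -- of the autoregressive process.
    calc ∑ m ∈ Finset.range (n + 1), (logLaplace ψ)^[m] 1 ⬝ᵥ (fun i => (⌊v (n - m) i⌋₊ : ℝ)) ≤
          ∑ m ∈ Finset.range (n + 1), (1 : Fin d → ℝ) ⬝ᵥ (meanMatrix ψ ^ m *ᵥ v (n - m)) := by
          refine Finset.sum_le_sum fun m _ => ?_
          rw [Matrix.dotProduct_mulVec]
          refine (dotProduct_le_dotProduct
            (iterate_logLaplace_le_vecMul hψ hint zero_le_one m) fun i => Nat.cast_nonneg _).trans ?_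
          refine Finset.sum_le_sum fun i _ => mul_le_mul_of_nonneg_left
            (Nat.floor_le (hv _ i)) ?_
          exact (iterate_logLaplace_nonneg hψ zero_le_one m i).trans
            (iterate_logLaplace_le_vecMul hψ hint zero_le_one m i)
      _ = (1 : Fin d → ℝ) ⬝ᵥ ∑ m ∈ Finset.range (n + 1), meanMatrix ψ ^ m *ᵥ v (n - m) := by
          rw [dotProduct_sum]
      _ ≤ d * b := one_dotProduct_le.trans (by gcongr)

/-- Exponential Markov inequality for $w=(t,\dots,t)$, since $\|Z_n\|\le b$ forces $w\cdot Z_n\le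
tdb$. The factors with $m<K$, where the lower bound on the iterates is not assumed, are estimated by
1. -/
lemma measure_norm_totalPopulation_le (hd : 1 ≤ d) (hψ : ∀ j, Measurable (ψ j))
    (hU : ∀ q, Measurable (U q)) (hUμ : ∀ q, P.map (U q) = volume) (hind : iIndepFun U P)
    {ρ t c : ℝ} (hρ : 0 ≤ ρ) (ht : 0 < t) (hc : 0 ≤ c) {K : ℕ}
    (hlow : ∀ m, K ≤ m → ∀ j, c * ρ ^ m ≤ (logLaplace ψ)^[m] (fun _ => t) j)
    {v : ℕ → Fin d → ℝ} (hv : ∀ m, 0 ≤ v m) (n : ℕ) (b : ℝ) :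
    P {ω | ‖totalPopulation ψ n (fun q => U q ω) v‖ ≤ b} ≤
      ENNReal.ofReal (Real.exp (t * (d * b))) * ∏ m : Fin n, (if (m : ℕ) < K then 1 else
        ENNReal.ofReal (Real.exp (-(c * ρ ^ (m : ℕ) * max (‖v (n - m)‖ - 1) 0)))) := by
  set w : Fin d → ℝ := fun _ => t with hwdef
  have hw : 0 ≤ w := fun _ => ht.le
  have hΦ := iterate_logLaplace_nonneg hψ hw
  have h1 := measure_le_exp_mul_lintegral (P := P) (a := t * (d * b))
    (measurable_dotProduct_totalPopulation hψ hU v w n)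
  rw [lintegral_exp_neg_dotProduct_totalPopulation hψ hU hUμ hind v hw n] at h1
  refine le_trans (measure_mono fun ω hω => ?_) (h1.trans ?_)
  · replace hω : ‖totalPopulation ψ n (fun q => U q ω) v‖ ≤ b := hω
    have h2 : w = t • (1 : Fin d → ℝ) := by ext; simp [hwdef]
    change w ⬝ᵥ _ ≤ _
    rw [h2, smul_dotProduct, smul_eq_mul]
    gcongr
    exact one_dotProduct_le.trans (by gcongr)
  · gcongr
    -- The term $m=n$ belongs to the immigration at time 0 and is split off; its factor is at most
    -- 1.
    rw [Finset.sum_range_succ, neg_add, Real.exp_add,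
      ENNReal.ofReal_mul (Real.exp_pos _).le, ← Fin.sum_univ_eq_sum_range (fun m =>
        (logLaplace ψ)^[m] w ⬝ᵥ fun i => (⌊v (n - m) i⌋₊ : ℝ)), ← Finset.sum_neg_distrib,
      Real.exp_sum, ENNReal.ofReal_prod_of_nonneg fun _ _ => (Real.exp_pos _).le]
    have hle1 : ∀ m, ENNReal.ofReal (Real.exp (-((logLaplace ψ)^[m] w ⬝ᵥ
        fun i => (⌊v (n - m) i⌋₊ : ℝ)))) ≤ 1 := fun m => by
      rw [ENNReal.ofReal_le_one, Real.exp_le_one_iff]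
      exact neg_nonpos.2 (dotProduct_nonneg' (hΦ m) fun i => Nat.cast_nonneg _)
    refine (mul_le_of_le_one_right zero_le (hle1 n)).trans
      (Finset.prod_le_prod' fun m _ => ?_)
    split_ifs with hm
    · exact hle1 m
    · refine ENNReal.ofReal_le_ofReal (Real.exp_le_exp.2 (neg_le_neg ?_))
      exact le_dotProduct_floor hd (by positivity) (hlow m (by omega)) (hv _)

/-- A large immigration at time 1 makes every coordinate large at time $K+1$: testing with $t$ times
a unit vector, each coordinate fails with probability at most $1/(2d)$, and a union bound leaves one
half. -/
lemma half_le_measure_le_totalPopulation (hd : 1 ≤ d) (hψ : ∀ j, Measurable (ψ j))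
    (hU : ∀ q, Measurable (U q)) (hUμ : ∀ q, P.map (U q) = volume) (hind : iIndepFun U P)
    {t c : ℝ} (ht : 0 < t) (hc : 0 < c) {K : ℕ}
    (hlow : ∀ i j, c ≤ (logLaplace ψ)^[K] (Pi.single i t) j) (x : Fin d → ℝ) :
    ∃ R : ℝ, ∀ v : ℕ → Fin d → ℝ, (∀ m, 0 ≤ v m) → R < ‖v 1‖ →
      2⁻¹ ≤ P {ω | x ≤ totalPopulation ψ (K + 1) (fun q => U q ω) v} := by
  have hdpos : (0 : ℝ) < d := by exact_mod_cast hd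
  -- Chosen so that $c(R-1)=t\|x\|+\log(2d)$; the 1 pays for rounding the immigration down.
  refine ⟨1 + (t * ‖x‖ + Real.log (2 * d)) / c, fun v hv hR => ?_⟩
  have hZ : Measurable fun ω => totalPopulation ψ (K + 1) (fun q => U q ω) v :=
    measurable_totalPopulation hψ _ (measurable_pi_lambda _ hU) measurable_const
  set bad : Fin d → Set Ω := fun i =>
    {ω | Pi.single i t ⬝ᵥ totalPopulation ψ (K + 1) (fun q => U q ω) v ≤ t * ‖x‖} with hbad
  have hbad_le : ∀ i, P (bad i) ≤ ENNReal.ofReal (1 / (2 * d)) := by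
    intro i
    have hw : (0 : Fin d → ℝ) ≤ Pi.single i t := Pi.single_nonneg.2 ht.le
    have h1 := measure_le_exp_mul_lintegral (P := P) (a := t * ‖x‖)
      (measurable_dotProduct_totalPopulation hψ hU v (Pi.single i t) (K + 1))
    rw [lintegral_exp_neg_dotProduct_totalPopulation hψ hU hUμ hind v hw] at h1
    refine h1.trans ?_
    rw [← ENNReal.ofReal_mul (Real.exp_pos _).le, ← Real.exp_add]
    refine ENNReal.ofReal_le_ofReal ?_
    have h2 : c * max (‖v 1‖ - 1) 0 ≤ ∑ m ∈ Finset.range (K + 1 + 1),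
        (logLaplace ψ)^[m] (Pi.single i t) ⬝ᵥ (fun i => (⌊v (K + 1 - m) i⌋₊ : ℝ)) := by
      refine (le_dotProduct_floor hd hc.le (hlow i) (hv 1)).trans ?_
      have h3 := Finset.single_le_sum (f := fun m => (logLaplace ψ)^[m] (Pi.single i t) ⬝ᵥ
        (fun i => (⌊v (K + 1 - m) i⌋₊ : ℝ))) (fun m _ => dotProduct_nonneg'
          (iterate_logLaplace_nonneg hψ hw m) fun i => Nat.cast_nonneg _)
        (Finset.mem_range.2 (show K < K + 1 + 1 by omega))
      simpa using h3
    have h4 : t * ‖x‖ + Real.log (2 * d) ≤ c * max (‖v 1‖ - 1) 0 := by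
      rw [← div_le_iff₀' hc]
      exact le_trans (by linarith) (le_max_left _ _)
    calc Real.exp (t * ‖x‖ + -∑ m ∈ Finset.range (K + 1 + 1),
          (logLaplace ψ)^[m] (Pi.single i t) ⬝ᵥ (fun i => (⌊v (K + 1 - m) i⌋₊ : ℝ))) ≤
          Real.exp (-Real.log (2 * d)) := Real.exp_le_exp.2 (by linarith)
      _ = 1 / (2 * d) := by rw [Real.exp_neg, Real.exp_log (by positivity), one_div]
  have hunion : P (⋃ i, bad i) ≤ 2⁻¹ := by
    refine (measure_iUnion_fintype_le _ _).trans ((Finset.sum_le_sum fun i _ => hbad_le i).trans ?_)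
    rw [Finset.sum_const, Finset.card_univ, Fintype.card_fin, nsmul_eq_mul,
      ← ENNReal.ofReal_natCast, ← ENNReal.ofReal_mul hdpos.le,
      show (d : ℝ) * (1 / (2 * d)) = 2⁻¹ by field_simp, ENNReal.ofReal_inv_of_pos two_pos]
    simp
  have hcover : (1 : ℝ≥0∞) ≤
      P {ω | x ≤ totalPopulation ψ (K + 1) (fun q => U q ω) v} + P (⋃ i, bad i) := by
    rw [← measure_univ (μ := P)]
    refine (measure_mono fun ω _ => ?_).trans (measure_union_le _ _)
    by_cases hω : x ≤ totalPopulation ψ (K + 1) (fun q => U q ω) v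
    · exact Or.inl hω
    · right
      rw [Pi.le_def] at hω
      push Not at hω
      obtain ⟨i, hi⟩ := hω
      refine Set.mem_iUnion.2 ⟨i, ?_⟩
      change Pi.single i t ⬝ᵥ _ ≤ t * ‖x‖
      rw [single_dotProduct]
      exact mul_le_mul_of_nonneg_left (hi.le.trans (le_norm_apply i)) ht.le
  have h5 : 2⁻¹ + (2⁻¹ : ℝ≥0∞) ≤
      P {ω | x ≤ totalPopulation ψ (K + 1) (fun q => U q ω) v} + 2⁻¹ := by
    rw [ENNReal.inv_two_add_inv_two]
    exact hcover.trans (by gcongr)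
  exact (ENNReal.add_le_add_iff_right (by norm_num)).1 h5

end Quenched

/-! ### Averaging over the immigration -/

section Annealed

variable {d : ℕ} {ψ : Reproduction d} {Ω : Type*} [MeasurableSpace Ω] {P : Measure Ω}
  [IsProbabilityMeasure P] {Ψ : ℕ → Ω → Reproduction d}
  {U : ℕ → ℕ → ℕ → Fin d → Ω → unitInterval} {Y : ℕ → Ω → Fin d → ℝ}

lemma measurable_fromZero (hY_meas : ∀ n, Measurable (Y n)) (n : ℕ) :
    Measurable (fromZero Y n) := by
  rcases eq_or_ne n 0 with rfl | hn
  · have : fromZero Y 0 = fun _ => 0 := by simp [fromZero]; rfl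
    rw [this]; exact measurable_const
  · rw [fromZero_of_ne_zero hn]; exact hY_meas n

lemma indepFun_fromZero {Ω : Type*} [MeasurableSpace Ω] {P : Measure Ω}
    {Y : ℕ → Ω → Fin d → ℝ} {E : Type*} [MeasurableSpace E] {f : Ω → E}
    (h : IndepFun f (fun ω n => Y n ω) P) : IndepFun f (fun ω n => fromZero Y n ω) P := by
  have hm : Measurable fun (y : ℕ → Fin d → ℝ) => Function.update y 0 0 :=
    measurable_pi_lambda _ fun n => by
      rcases eq_or_ne n 0 with rfl | hn
      · simp
      · simp [hn, measurable_pi_apply]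
  have h1 := h.comp measurable_id hm
  have h2 : (fun y : ℕ → Fin d → ℝ => Function.update y 0 0) ∘ (fun ω n => Y n ω) =
      fun ω n => fromZero Y n ω := by
    funext ω n
    rcases eq_or_ne n 0 with rfl | hn
    · simp [fromZero]
    · simp [fromZero, hn]
  rwa [h2] at h1

/-- The law of the branching process as a mixture over the immigration. -/
lemma measure_branchingProcess_mem (hψ : ∀ j, Measurable (ψ j))
    (hΨ : ∀ᵐ ω ∂P, ∀ n, 1 ≤ n → Ψ n ω = ψ) (hU : ∀ m l k j, Measurable (U m l k j))
    (hUY : IndepFun (fun ω (q : ℕ × ℕ × ℕ × Fin d) => U q.1 q.2.1 q.2.2.1 q.2.2.2 ω)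
      (fun ω n => Y n ω) P) (hY_meas : ∀ n, Measurable (Y n)) (n : ℕ) {S : Set (Fin d → ℝ)}
    (hS : MeasurableSet S) :
    P {ω | branchingProcess Ψ U Y n ω ∈ S} =
      ∫⁻ ω', P {ω | totalPopulation ψ n (fun q => U q.1 q.2.1 q.2.2.1 q.2.2.2 ω)
        (fun m => Y m ω') ∈ S} ∂P := by
  have hUm : Measurable fun ω (q : ℕ × ℕ × ℕ × Fin d) => U q.1 q.2.1 q.2.2.1 q.2.2.2 ω :=
    measurable_pi_lambda _ fun q => hU _ _ _ _
  have hYm : Measurable fun ω n => Y n ω := measurable_pi_lambda _ hY_meas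
  have hind : ∀ {Ω' : Type _} [MeasurableSpace Ω'] {μ : Measure Ω'} {f : Ω' → Fin d → ℝ},
      Measurable f → μ {ω | f ω ∈ S} = ∫⁻ ω, S.indicator 1 (f ω) ∂μ := fun {Ω'} _ {μ f} hf => by
    exact (lintegral_indicator_one (show MeasurableSet {ω | f ω ∈ S} from hf hS)).symm
  have h1 : P {ω | branchingProcess Ψ U Y n ω ∈ S} = P {ω | totalPopulation ψ n
      (fun q => U q.1 q.2.1 q.2.2.1 q.2.2.2 ω) (fun m => Y m ω) ∈ S} := by
    refine measure_congr ?_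
    filter_upwards [hΨ] with ω hω
    change (branchingProcess Ψ U Y n ω ∈ S) = (_ ∈ S)
    rw [branchingProcess_eq_totalPopulation hω]
  rw [h1, hind (measurable_totalPopulation hψ n hUm hYm),
    lintegral_eq_lintegral_lintegral_of_indepFun hUm hYm hUY
      (H := fun p => S.indicator 1 (totalPopulation ψ n p.1 p.2))
      ((measurable_one.indicator hS).comp
        (measurable_totalPopulation hψ n measurable_fst measurable_snd))]
  exact lintegral_congr fun ω' =>
    (hind (measurable_totalPopulation hψ n hUm measurable_const)).symm

lemma branchingProcess_irreducible (hd : 1 ≤ d) (hψ : ∀ j, Measurable (ψ j))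
    (hΨ : ∀ᵐ ω ∂P, ∀ n, 1 ≤ n → Ψ n ω = ψ) (hU : ∀ m l k j, Measurable (U m l k j))
    (hUμ : ∀ m l k j, P.map (U m l k j) = volume)
    (hind : iIndepFun (fun (q : ℕ × ℕ × ℕ × Fin d) => U q.1 q.2.1 q.2.2.1 q.2.2.2) P)
    (hUY : IndepFun (fun ω (q : ℕ × ℕ × ℕ × Fin d) => U q.1 q.2.1 q.2.2.1 q.2.2.2 ω)
      (fun ω n => Y n ω) P)
    (hlog : ∀ i j, Integrable fun u => offspringVec ψ j u i * Real.log (offspringVec ψ j u i))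
    (hM : (meanMatrix ψ).IsPrimitive) (hρ : specRadius (meanMatrix ψ) < 1)
    (hY_meas : ∀ n, Measurable (Y n)) (hY_nonneg : ∀ n ω, 0 ≤ Y n ω)
    (hY_unbdd : ∀ r : ℝ, 0 < P {ω | r < ‖Y 1 ω‖}) :
    IrreducibleFromZero P (branchingProcess Ψ U (fromZero Y)) := by
  intro x _
  obtain ⟨t, ht, c, hc, K, hlow⟩ := exists_mul_pow_le_iterate_logLaplace hd hψ hlog hM hρ
  have hρ0 := (exists_pow_bounds hd hM).1
  obtain ⟨R, hR⟩ := half_le_measure_le_totalPopulation (P := P)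
    (U := fun q => U q.1 q.2.1 q.2.2.1 q.2.2.2) hd hψ (fun q => hU _ _ _ _)
    (fun q => hUμ _ _ _ _) hind ht (c := c * specRadius (meanMatrix ψ) ^ K) (by positivity)
    (K := K) (fun i j => hlow _ (Pi.single_nonneg.2 ht.le)
      (fun k => by
        rcases eq_or_ne k i with rfl | hk
        · simp
        · simpa [hk] using ht.le) ⟨i, by simp⟩ K le_rfl j) x
  have hset : MeasurableSet {ω | R < ‖Y 1 ω‖} := measurableSet_lt measurable_const (hY_meas 1).norm
  refine ⟨K + 1, lt_of_lt_of_le ?_ (measure_branchingProcess_mem hψ hΨ hU (indepFun_fromZero hUY)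
    (measurable_fromZero hY_meas) (K + 1) (measurableSet_Ici (a := x))).ge⟩
  calc 0 < 2⁻¹ * P {ω | R < ‖Y 1 ω‖} := ENNReal.mul_pos (by norm_num) (hY_unbdd R).ne'
    _ = ∫⁻ ω', {ω | R < ‖Y 1 ω‖}.indicator (fun _ => 2⁻¹) ω' ∂P :=
        (lintegral_indicator_const hset _).symm
    _ ≤ _ := by
        refine lintegral_mono fun ω' => Set.indicator_apply_le' (fun hω' => ?_) fun _ => zero_le
        refine hR (fun m => fromZero Y m ω') (fun m => fromZero_nonneg hY_nonneg m ω') ?_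
        rw [fromZero_of_ne_zero one_ne_zero]
        exact hω'

/-- For each immigration sequence with $\|X_n\|\le b$, the conditional probability that
$\|Z_n\|\le2db$ is at least a positive constant not depending on $n$. Integrating over this event
compares the two series. -/
lemma branchingRecurrent_of_arRecurrent (hd : 1 ≤ d) (hψ : ∀ j, Measurable (ψ j))
    (hΨ : ∀ᵐ ω ∂P, ∀ n, 1 ≤ n → Ψ n ω = ψ) (hU : ∀ m l k j, Measurable (U m l k j))
    (hUμ : ∀ m l k j, P.map (U m l k j) = volume)
    (hind : iIndepFun (fun (q : ℕ × ℕ × ℕ × Fin d) => U q.1 q.2.1 q.2.2.1 q.2.2.2) P)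
    (hUY : IndepFun (fun ω (q : ℕ × ℕ × ℕ × Fin d) => U q.1 q.2.1 q.2.2.1 q.2.2.2 ω)
      (fun ω n => Y n ω) P)
    (hlog : ∀ i j, Integrable fun u => offspringVec ψ j u i * Real.log (offspringVec ψ j u i))
    (hM : (meanMatrix ψ).IsPrimitive) (hρ : specRadius (meanMatrix ψ) < 1)
    (hY_meas : ∀ n, Measurable (Y n)) (hY_nonneg : ∀ n ω, 0 ≤ Y n ω)
    (hY_unbdd : ∀ r : ℝ, 0 < P {ω | r < ‖Y 1 ω‖})
    {A : ℕ → Ω → Matrix (Fin d) (Fin d) ℝ}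
    (hA : ∀ᵐ ω ∂P, ∀ n, 1 ≤ n → A n ω = meanMatrix ψ) (h : ARRecurrent P A Y) :
    BranchingRecurrent P Ψ U Y := by
  obtain ⟨-, b, hb, hsum⟩ := h
  have hdpos : (0 : ℝ) < d := by exact_mod_cast hd
  have hirr := branchingProcess_irreducible hd hψ hΨ hU hUμ hind hUY hlog hM hρ hY_meas hY_nonneg
    hY_unbdd
  set c := ENNReal.ofReal (Real.exp (-(d * b)) - Real.exp (-(2 * (d * b)))) with hc
  have hc0 : c ≠ 0 := by
    rw [hc, Ne, ENNReal.ofReal_eq_zero, not_le, sub_pos, Real.exp_lt_exp]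
    have : 0 < d * b := by positivity
    linarith
  refine RecurrentFromZero.of_le_const_mul hirr (b := 2 * (d * b)) (by positivity) hc0
    (fun n => ?_) hsum
  have hmem := measure_branchingProcess_mem hψ hΨ hU (indepFun_fromZero hUY)
    (measurable_fromZero hY_meas) n (S := {z | ‖z‖ ≤ 2 * (d * b)})
    (measurableSet_le measurable_norm measurable_const)
  refine le_trans ?_ hmem.ge
  -- The explicit sum replaces `arProcess`, whose coefficient matrices are constant only almost
  -- surely and carry no measurability assumption.
  set X : Ω → Fin d → ℝ := fun ω => ∑ m ∈ Finset.range (n + 1),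
    meanMatrix ψ ^ m *ᵥ fromZero Y (n - m) ω with hX
  have hXm : Measurable X := by
    refine Finset.measurable_sum _ fun m _ => measurable_pi_lambda _ fun i => ?_
    simp only [Matrix.mulVec, dotProduct]
    exact Finset.measurable_sum _ fun j _ =>
      ((measurable_pi_apply j).comp (measurable_fromZero hY_meas _)).const_mul _
  have hXset : MeasurableSet {ω | ‖X ω‖ ≤ b} := measurableSet_le hXm.norm measurable_const
  have hXP : P {ω | ‖(arProcess A (fromZero Y) n ω)‖ ≤ b} ≤ P {ω | ‖X ω‖ ≤ b} := by
    refine measure_mono_ae ?_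
    filter_upwards [hA] with ω hω (hle : _ ≤ _)
    rw [arProcess_eq_sum hω] at hle
    exact hle
  calc _ ≤ c * P {ω | ‖X ω‖ ≤ b} := by gcongr
    _ = ∫⁻ ω', {ω | ‖X ω‖ ≤ b}.indicator (fun _ => c) ω' ∂P :=
        (lintegral_indicator_const hXset _).symm
    _ ≤ _ := by
        refine lintegral_mono fun ω' => Set.indicator_apply_le' (fun hω' => ?_) fun _ => zero_le
        exact exp_sub_exp_le_measure_totalPopulation
          (U := fun q => U q.1 q.2.1 q.2.2.1 q.2.2.2) hψ (integrable_offspringVec hψ hlog)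
          (fun q => hU _ _ _ _) (fun q => hUμ _ _ _ _) hind
          (fun m => fromZero_nonneg hY_nonneg m ω') hω'

/-- Since $s\le1$, replacing $r-1$ by $r$ costs at most the factor $e^c$; then $e^{-x}\le x^{-1}$.
-/
lemma exp_neg_mul_le_inv {c s r : ℝ} (hc : 0 < c) (hs0 : 0 ≤ s) (hs1 : s ≤ 1) (hsr : 0 < s * r) :
    Real.exp (-(c * s * max (r - 1) 0)) ≤ Real.exp c / c * (s * r)⁻¹ := by
  have h1 : c * s * (r - 1) ≤ c * s * max (r - 1) 0 :=
    mul_le_mul_of_nonneg_left (le_max_left _ _) (by positivity)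
  have h2 : c * s ≤ c := mul_le_of_le_one_right hc.le hs1
  have h3 : Real.exp (-(c * (s * r))) ≤ (c * (s * r))⁻¹ := by
    rw [Real.exp_neg]
    exact inv_anti₀ (by positivity) (by linarith [Real.add_one_le_exp (c * (s * r))])
  calc _ ≤ Real.exp (c + -(c * (s * r))) := Real.exp_le_exp.2 (by nlinarith)
    _ = Real.exp c * Real.exp (-(c * (s * r))) := Real.exp_add _ _
    _ ≤ Real.exp c * (c * (s * r))⁻¹ := by gcongr
    _ = _ := by rw [mul_inv]; ring

/-- The quenched bound is a product over the immigration whose factors decay exponentially in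
$\varrho^m\|Y_{n-m}\|$, hence faster than its inverse, as the comparison of products requires. -/
lemma criterionDiverges_of_branchingRecurrent (hd : 1 ≤ d) (hψ : ∀ j, Measurable (ψ j))
    (hΨ : ∀ᵐ ω ∂P, ∀ n, 1 ≤ n → Ψ n ω = ψ) (hU : ∀ m l k j, Measurable (U m l k j))
    (hUμ : ∀ m l k j, P.map (U m l k j) = volume)
    (hind : iIndepFun (fun (q : ℕ × ℕ × ℕ × Fin d) => U q.1 q.2.1 q.2.2.1 q.2.2.2) P)
    (hUY : IndepFun (fun ω (q : ℕ × ℕ × ℕ × Fin d) => U q.1 q.2.1 q.2.2.1 q.2.2.2 ω)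
      (fun ω n => Y n ω) P)
    (hlog : ∀ i j, Integrable fun u => offspringVec ψ j u i * Real.log (offspringVec ψ j u i))
    (hM : (meanMatrix ψ).IsPrimitive) (hρ : specRadius (meanMatrix ψ) < 1)
    (hY_meas : ∀ n, Measurable (Y n)) (hY_nonneg : ∀ n ω, 0 ≤ Y n ω) (hY_indep : iIndepFun Y P)
    (hY_ident : ∀ n, 1 ≤ n → IdentDistrib (Y n) (Y 1) P P)
    {y : ℝ} (hy : 0 < y) (hYy : 0 < P {ω | ‖Y 1 ω‖ ≤ y}) (h : BranchingRecurrent P Ψ U Y) :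
    CriterionDiverges P Y y (specRadius (meanMatrix ψ)) := by
  obtain ⟨-, b, hb, hsum⟩ := h
  obtain ⟨t, ht, c, hc, K, hlow⟩ := exists_mul_pow_le_iterate_logLaplace hd hψ hlog hM hρ
  have hρ0 := (exists_pow_bounds hd hM).1
  set ρ := specRadius (meanMatrix ψ)
  refine criterionDiverges_of_le_lintegral_prod hY_meas hY_indep hY_ident hρ0 hρ hy hYy
    (D := Real.exp c / c) (by positivity) (K := K) (C := ENNReal.ofReal (Real.exp (t * (d * b))))
    (h := fun m r => if m < K then 1 else
      ENNReal.ofReal (Real.exp (-(c * ρ ^ m * max (r - 1) 0)))) (fun m => ?_) (fun m r => ?_)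
    (fun m r hm hr => ?_) ENNReal.ofReal_ne_top (fun n => ?_) hsum
  · split_ifs
    · exact measurable_const
    · fun_prop
  · split_ifs
    · exact le_rfl
    · rw [ENNReal.ofReal_le_one, Real.exp_le_one_iff, neg_nonpos]
      positivity
  · rw [if_neg (by omega)]
    exact ENNReal.ofReal_le_ofReal (exp_neg_mul_le_inv hc (by positivity)
      (pow_le_one₀ hρ0.le hρ.le) (hy.trans hr))
  · have hmem := measure_branchingProcess_mem hψ hΨ hU (indepFun_fromZero hUY)
      (measurable_fromZero hY_meas) n (S := {z | ‖z‖ ≤ b})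
      (measurableSet_le measurable_norm measurable_const)
    refine hmem.le.trans ?_
    rw [← lintegral_const_mul' _ _ ENNReal.ofReal_ne_top]
    refine lintegral_mono fun ω' => ?_
    refine (measure_norm_totalPopulation_le (U := fun q => U q.1 q.2.1 q.2.2.1 q.2.2.2) hd hψ
      (fun q => hU _ _ _ _) (fun q => hUμ _ _ _ _) hind hρ0.le ht hc.le
      (hlow _ (fun _ => ht.le) (fun _ => le_rfl) ⟨⟨0, hd⟩, rfl⟩)
      (fun m => fromZero_nonneg hY_nonneg m ω') n b).trans (le_of_eq ?_)
    congr 1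
    refine Finset.prod_congr rfl fun m _ => ?_
    rw [fromZero_of_ne_zero (by have := m.2; omega)]

end Annealed

lemma integrable_mul_log_offspringVec {d : ℕ} {ψ : Reproduction d} {Ω : Type*}
    [MeasurableSpace Ω] {P : Measure Ω} {Ψ : ℕ → Ω → Reproduction d}
    {U : ℕ → ℕ → ℕ → Fin d → Ω → unitInterval} (hψ : ∀ j, Measurable (ψ j))
    (hΨ : ∀ᵐ ω ∂P, ∀ n, 1 ≤ n → Ψ n ω = ψ) (hU : ∀ m l k j, Measurable (U m l k j))
    (hUμ : ∀ m l k j, P.map (U m l k j) = volume)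
    (h : ∀ i j, Integrable (fun ω => (offspring Ψ U 0 0 0 i j ω : ℝ) *
        Real.log (offspring Ψ U 0 0 0 i j ω : ℝ)) P) (i j : Fin d) :
    Integrable fun u => offspringVec ψ j u i * Real.log (offspringVec ψ j u i) := by
  have hm := measurable_offspringVec hψ i j
  rw [← hUμ 0 0 0 j]
  refine (integrable_map_measure (g := fun u => offspringVec ψ j u i *
    Real.log (offspringVec ψ j u i)) (hm.mul hm.log).aestronglyMeasurable
    (hU 0 0 0 j).aemeasurable).2 ?_
  refine (h i j).congr ?_
  filter_upwards [hΨ] with ω hω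
  simp only [offspring, hω _ (Nat.le_add_left 1 (0 + 0))]
  rfl

end ARBranching

theorem theorem3p1 {Ω : Type*} [MeasurableSpace Ω] (P : Measure Ω) [IsProbabilityMeasure P]
    (d : ℕ) (hd : 1 ≤ d)
    -- innovations: values in `[0,∞)^d`, independent, identically distributed for `n ≥ 1`,
    -- with unbounded support
    (Y : ℕ → Ω → Fin d → ℝ)
    (hY_meas : ∀ n, Measurable (Y n))
    (hY_nonneg : ∀ n ω, 0 ≤ Y n ω)
    (hY_indep : iIndepFun Y P)
    (hY_ident : ∀ n, 1 ≤ n → IdentDistrib (Y n) (Y 1) P P)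
    (hY_unbdd : ∀ r : ℝ, 0 < P {ω | r < ‖Y 1 ω‖})
    -- coefficient matrices: almost surely equal to one primitive matrix of spectral radius `< 1`
    (A : ℕ → Ω → Matrix (Fin d) (Fin d) ℝ)
    (A₀ : Matrix (Fin d) (Fin d) ℝ)
    (hA₀ : A₀.IsPrimitive)
    (hρ : ARBranching.specRadius A₀ < 1)
    (hA : ∀ᵐ ω ∂P, ∀ n, 1 ≤ n → A n ω = A₀)
    (y : ℝ) (hy : 0 < y) (hYy : 0 < P {ω | ‖Y 1 ω‖ ≤ y}) :
    [ARBranching.ARRecurrent P A Y,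
      ARBranching.MaxARRecurrent P A Y,
      ARBranching.CriterionDiverges P Y y (ARBranching.specRadius A₀)].TFAE ∧
    ∀ (Ψ : ℕ → Ω → ARBranching.Reproduction d) (ψ : ARBranching.Reproduction d)
      (U : ℕ → ℕ → ℕ → Fin d → Ω → unitInterval),
      -- constant environment
      (∀ j, Measurable (ψ j)) →
      (∀ᵐ ω ∂P, ∀ n, 1 ≤ n → Ψ n ω = ψ) →
      -- i.i.d. uniform variables, independent of the immigration
      (∀ m l k j, Measurable (U m l k j)) →
      (∀ m l k j, P.map (U m l k j) = volume) →
      iIndepFun (fun (q : ℕ × ℕ × ℕ × Fin d) => U q.1 q.2.1 q.2.2.1 q.2.2.2) P →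
      IndepFun (fun ω (q : ℕ × ℕ × ℕ × Fin d) => U q.1 q.2.1 q.2.2.1 q.2.2.2 ω)
        (fun ω n => Y n ω) P →
      -- the coefficient matrices are the mean offspring matrices
      (∀ᵐ ω ∂P, ∀ n, 1 ≤ n → A n ω = ARBranching.meanMatrix (Ψ n ω)) →
      -- moment condition on the offspring numbers
      (∀ i j, Integrable (fun ω => (ARBranching.offspring Ψ U 0 0 0 i j ω : ℝ) *
        Real.log (ARBranching.offspring Ψ U 0 0 0 i j ω : ℝ)) P) →
      [ARBranching.ARRecurrent P A Y,
        ARBranching.MaxARRecurrent P A Y,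
        ARBranching.CriterionDiverges P Y y (ARBranching.specRadius A₀),
        ARBranching.BranchingRecurrent P Ψ U Y].TFAE := by
  have hXM := ARBranching.maxARRecurrent_of_arRecurrent hd hY_nonneg hY_unbdd hA₀ hA
  have hMC := ARBranching.criterionDiverges_of_maxARRecurrent hd hY_meas hY_nonneg hY_indep
    hY_ident hA₀ hρ hA hy hYy
  have hCX := ARBranching.arRecurrent_of_criterionDiverges hd hY_meas hY_nonneg hY_indep
    hY_ident hY_unbdd hA₀ hρ hA hy hYy
  refine ⟨?_, fun Ψ ψ U hψ hΨ hU hUμ hind hUY hmean hlog => ?_⟩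
  · tfae_have 1 → 2 := hXM
    tfae_have 2 → 3 := hMC
    tfae_have 3 → 1 := hCX
    tfae_finish
  -- Both matrices are deterministic, so a single sample point in the intersection of the almost
  -- sure events identifies them.
  · obtain rfl : A₀ = ARBranching.meanMatrix ψ := by
      obtain ⟨ω, h1, h2, h3⟩ := (hA.and (hmean.and hΨ)).exists
      rw [← h1 1 le_rfl, h2 1 le_rfl, h3 1 le_rfl]
    have hlog' := ARBranching.integrable_mul_log_offspringVec hψ hΨ hU hUμ hlog
    tfae_have 1 → 2 := hXM
    tfae_have 2 → 3 := hMC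
    tfae_have 3 → 1 := hCX
    tfae_have 1 → 4 := ARBranching.branchingRecurrent_of_arRecurrent hd hψ hΨ hU hUμ hind hUY
      hlog' hA₀ hρ hY_meas hY_nonneg hY_unbdd hA
    tfae_have 4 → 3 := ARBranching.criterionDiverges_of_branchingRecurrent hd hψ hΨ hU hUμ hind
      hUY hlog' hA₀ hρ hY_meas hY_nonneg hY_indep hY_ident hy hYy
    tfae_finish
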